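/- Let $(X,d)$ be a set with a distance function and let $p\ge 0$; put $d(x,x)^p=0$ for all $p\ge0$ (so that $d^0$ is the discrete metric). $(X,d)$ is of *$p$-negative type* if $\sum_{i,j} d(x_i,x_j)^p\,\xi_i\xi_j\le 0$ for all finite sets of distinct points $x_1,\dots,x_k\in X$ and all real $\xi_1,\dots,\xi_k$ with $\sum_i\xi_i=0$, and $\wp(X)=\sup\{p\ge 0 : (X,d)\text{ is of }p\text{-negative type}\}\in[0,\infty]$. A *$p$-polygonal equality* in $(X,d)$ is an equality $$\sum_{i=1}^s\sum_{j=1}^t m_in_j\,d(x_i,y_j)^p=\sum_{i_1<i_2}m_{i_1}m_{i_2}\,d(x_{i_1},x_{i_2})^p+\sum_{j_1<j_2}n_{j_1}n_{j_2}\,d(y_{j_1},y_{j_2})^p$$ for (not necessarily distinct) points $x_1,\dots,x_s,y_1,\dots,y_t\in X$ and real weights with $m_1+\dots+m_s=n_1+\dots+n_t$. It is *nontrivial* if the weighted points can be reduced (by amalgamating repeated points, deleting points of weight zero, and transferring a point of weight $w$ to the other side with weight $-w$) to a configuration with $s,t\ge1$, distinct points and strictly positive weights; equivalently, if the net weight $\sum_{x_i=z}m_i-\sum_{y_j=z}n_j$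 is nonzero for some $z\in X$. Let $P_X$ be the set of all $p\ge0$ for which $(X,d)$ admits a nontrivial $p$-polygonal equality. 1. If $(X,d)$ is a metric space with $\wp(X)=0$, then $P_X=(0,\infty)$. 2. Let $H$ be an infinite-dimensional real or complex Hilbert space, let $0<q\le\infty$ with $q\ne2$, and let $\mathcal C_q$ be the Schatten $q$-class of $H$: the compact operators on $H$ whose singular values, counted with multiplicity, are $q$-summable (all compact operators, with the operator norm, if $q=\infty$), with the metric $\|S-T\|_q$ if $q\ge1$ and $\|S-T\|_q^q$ if $q<1$. Then $\wp(\mathcal C_q)=0$ and $P_{\mathcal C_q}=(0,\infty)$; in particular, $\mathcal C_q$ admits a nontrivial $p$-polygonal equality for every $p>0$. -/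

import Mathlib

open scoped ENNReal

noncomputable section

/-! ### Negative type and polygonal equalities

All notions are attached to a set `X` with a distance function `d : X → X → ℝ`. -/

open Classical in
/-- The entry `d(x, y) ^ p` of the `p`-distance matrix, which vanishes on the diagonal for every
`p ≥ 0`. In particular `d ^ 0` is the discrete metric (whereas `(0 : ℝ) ^ (0 : ℝ) = 1`). -/
def powDist {X : Type*} (d : X → X → ℝ) (p : ℝ) (x y : X) : ℝ :=
  if x = y then 0 else d x y ^ p

/-- `(X, d)` is of `p`-negative type: for every finite subspace `S` and all real weights `ξ` on `S`
with sum zero, the quadratic form of the `p`-distance matrix of `S` is nonpositive at `ξ`. -/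
def IsNegativeType {X : Type*} (d : X → X → ℝ) (p : ℝ) : Prop :=
  ∀ (S : Finset X) (ξ : X → ℝ), ∑ x ∈ S, ξ x = 0 →
    ∑ x ∈ S, ∑ y ∈ S, powDist d p x y * ξ x * ξ y ≤ 0

/-- The supremal negative type `sup {p ≥ 0 : (X, d) is of p-negative type}`, in `[0, ∞]`. -/
def supremalNegativeType {X : Type*} (d : X → X → ℝ) : ℝ≥0∞ :=
  ⨆ p ∈ {p : ℝ | 0 ≤ p ∧ IsNegativeType d p}, ENNReal.ofReal p

/-- A signed `(s, t)`-simplex `[x_i(m_i); y_j(n_j)]`: (not necessarily distinct) points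
`x_1, …, x_s, y_1, …, y_t` with real weights such that `m_1 + ⋯ + m_s = n_1 + ⋯ + n_t`. -/
structure SignedSimplex (X : Type*) where
  s : ℕ
  t : ℕ
  x : Fin s → X
  y : Fin t → X
  m : Fin s → ℝ
  n : Fin t → ℝ
  balanced : ∑ i, m i = ∑ j, n j

namespace SignedSimplex

variable {X : Type*}

/-- The `p`-simplex gap. -/
def gap (d : X → X → ℝ) (p : ℝ) (Q : SignedSimplex X) : ℝ :=
  ∑ i, ∑ j, Q.m i * Q.n j * powDist d p (Q.x i) (Q.y j)
    - ∑ i₁, ∑ i₂ ∈ Finset.Ioi i₁, Q.m i₁ * Q.m i₂ * powDist d p (Q.x i₁) (Q.x i₂)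
    - ∑ j₁, ∑ j₂ ∈ Finset.Ioi j₁, Q.n j₁ * Q.n j₂ * powDist d p (Q.y j₁) (Q.y j₂)

/-- The points `x_1, …, x_s, y_1, …, y_t` (`s, t ≥ 1`) are distinct and all weights are strictly
positive. -/
structure CompletelyRefined (Q : SignedSimplex X) : Prop where
  s_pos : 0 < Q.s
  t_pos : 0 < Q.t
  x_injective : Function.Injective Q.x
  y_injective : Function.Injective Q.y
  x_ne_y : ∀ i j, Q.x i ≠ Q.y j
  m_pos : ∀ i, 0 < Q.m i
  n_pos : ∀ j, 0 < Q.n j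

open Classical in
/-- The net weight `∑_{x_i = z} m_i - ∑_{y_j = z} n_j` of a point `z`. -/
def netWeight (Q : SignedSimplex X) (z : X) : ℝ :=
  (∑ i, if Q.x i = z then Q.m i else 0) - ∑ j, if Q.y j = z then Q.n j else 0

/-- `Q` reduces to `R` by amalgamating repeated points, deleting points of weight zero and
transferring a point of weight `w` to the other side with weight `-w`. These operations keep the
net weight of every point, and lead to `R` (or from `R` to a common simplex, up to the order of
the points) exactly if the net weights agree. -/
def ReducesTo (Q R : SignedSimplex X) : Prop :=
  ∀ z, Q.netWeight z = R.netWeight z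

/-- `Q` can be reduced to a completely refined simplex. -/
def Nondegenerate (Q : SignedSimplex X) : Prop :=
  ∃ R : SignedSimplex X, R.CompletelyRefined ∧ Q.ReducesTo R

end SignedSimplex

/-- `(X, d)` admits a nontrivial `p`-polygonal equality. -/
def HasNontrivialPolygonalEquality {X : Type*} (d : X → X → ℝ) (p : ℝ) : Prop :=
  ∃ Q : SignedSimplex X, Q.Nondegenerate ∧ Q.gap d p = 0

/-- The set `P_(X, d)` of all `p ≥ 0` such that `(X, d)` admits a nontrivial `p`-polygonal
equality. -/
def polygonalSet {X : Type*} (d : X → X → ℝ) : Set ℝ :=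
  {p : ℝ | 0 ≤ p ∧ HasNontrivialPolygonalEquality d p}

/-! ### Schatten classes -/

section Schatten

variable {𝕜 H : Type*} [RCLike 𝕜] [NormedAddCommGroup H] [InnerProductSpace 𝕜 H] [CompleteSpace H]

/-- The multiplicity of `s > 0` as a singular value of `T`, i.e. as an eigenvalue of
`|T| = (T* T)^{1/2}`: the dimension of the eigenspace of `T* T` for `s ^ 2`. -/
def singularMultiplicity (T : H →L[𝕜] H) (s : ℝ) : ℕ :=
  Module.finrank 𝕜
    (Module.End.eigenspace ((ContinuousLinearMap.adjoint T ∘L T : H →L[𝕜] H) : H →ₗ[𝕜] H)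
      ((s ^ 2 : ℝ) : 𝕜))

/-- The sum of the `q`-th powers of the (nonzero) singular values of `T`, counted with
multiplicity. -/
def schattenSum (q : ℝ) (T : H →L[𝕜] H) : ℝ≥0∞ :=
  ∑' s : Set.Ioi (0 : ℝ), (singularMultiplicity T s : ℝ≥0∞) * ENNReal.ofReal ((s : ℝ) ^ q)

/-- `T` is in the Schatten class `C_q`, `0 < q ≤ ∞`: it is compact and, if `q < ∞`, its singular
values are `q`-summable. -/
def IsSchatten (q : ℝ≥0∞) (T : H →L[𝕜] H) : Prop :=
  IsCompactOperator T ∧ (q ≠ ∞ → schattenSum q.toReal T < ∞)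

/-- The Schatten `q`-norm (a quasi-norm for `q < 1`); the operator norm if `q = ∞`. -/
def schattenNorm (q : ℝ≥0∞) (T : H →L[𝕜] H) : ℝ :=
  if q = ∞ then ‖T‖ else (schattenSum q.toReal T).toReal ^ (1 / q.toReal)

variable (𝕜 H) in
/-- The Schatten class `C_q` of operators on `H`. -/
def SchattenClass (q : ℝ≥0∞) : Type _ := {T : H →L[𝕜] H // IsSchatten q T}

/-- The metric of `C_q`: `‖S - T‖_q` for `q ≥ 1`, and `‖S - T‖_q ^ q` for `0 < q < 1`. -/
def schattenDist (q : ℝ≥0∞) (S T : SchattenClass 𝕜 H q) : ℝ :=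
  schattenNorm q (S.1 - T.1) ^ (min 1 q).toReal

end Schatten

end

/-! ### Polygonal equalities and isotropic vectors -/

section PolygonalEqualities

open Finset

/-! The `p`-simplex gap is `-1/2` times the quadratic form of the `p`-distance matrix at the net
weights (`gap_eq`), so a nontrivial `p`-polygonal equality is a nonzero isotropic vector of sum
zero. For `p = 0` the form is negative definite on such vectors, so there is none. If `p > 0` and
negative type fails, the form is positive at some vector and negative at `δ_a - δ_b`; an isotropic
vector lies on the segment between them. Both claims thus reduce to the failure of `p`-negative type
for all `p > 0`.

Suppose that `C_q` is of `p`-negative type, and put `r = min(1, q) p`, `t = 1/q` (`t = 0` for `q =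
∞`). On real matrices of every size, embedded in `C_q` by an isometry into `H`, the function `ψ =
‖·‖_q ^ r` is continuous, homogeneous of degree `r` and negative definite. It has to be shown that
`t = 1/2`.

For `r ≥ 2`, the parallelogram inequality at `diag(1, 0), diag(0, 1)` and at `diag(1, 1), diag(1,
-1)` gives `r ≤ 1 + t r ≤ 2`, so `r = 2` and `t = 1/2`.

For `r < 2`, compare the all-ones matrix of size `n = 2 ^ k`, of norm `n`, with a Hadamard matrix,
of norm `n ^ (1/2 + t)`. Random signs on rows and columns preserve singular values and turn either
matrix into a random vector with identity covariance and bounded fourth moments.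
`IsHomNegDefFun.le_of_isotropic` says that `ψ` at two such families differs by at most a factor
independent of `n`. As `n → ∞`, this forces `1/2 + t = 1`.

The comparison passes through the Gaussian average `A` of `ψ`. Let `w` be uniform in the family and
`Z` an independent standard Gaussian scalar. Then `E ψ(Z w) ≤ A`: the energy inequality shows that
averaging the covariances of centred Gaussian laws does not decrease the mean of `ψ`. Conversely `E
ψ(Z w) ≥ (2 - 2 ^ (r/2)) / 18 * A`: the signed measure `17/18 δ_0 + 1/18 γ - law(Z w)`, with `γ` the
standard Gaussian, has a nonnegative Fourier transform by the fourth moment bound, so it is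
nonnegative at the positive definite second differences of `ψ`; it remains to average over the step
of the difference. -/

theorem Fin.sum_sum_eq_two_mul_sum_Ioi {s : ℕ} (a : Fin s → Fin s → ℝ)
    (hsymm : ∀ i j, a i j = a j i) (hdiag : ∀ i, a i i = 0) :
    ∑ i, ∑ j, a i j = 2 * ∑ i, ∑ j ∈ Ioi i, a i j := by
  have h1 : ∀ i, ∑ j, a i j = ∑ j ∈ Iio i, a i j + ∑ j ∈ Ioi i, a i j := by
    intro i
    have hu : (univ : Finset (Fin s)) = (Iio i ∪ Ioi i) ∪ {i} := by
      ext j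
      simp only [mem_univ, mem_union, mem_Iio, mem_Ioi, mem_singleton, true_iff]
      rcases lt_trichotomy j i with h | h | h <;> simp [h]
    rw [hu, sum_union, sum_union]
    · simp [hdiag]
    · rw [disjoint_left]
      intro j hj hj'
      simp only [mem_Iio, mem_Ioi] at hj hj'
      exact absurd hj (not_lt.2 hj'.le)
    · simp
  simp_rw [h1, sum_add_distrib]
  have h2 : ∑ i, ∑ j ∈ Iio i, a i j = ∑ i, ∑ j ∈ Ioi i, a i j := by
    rw [sum_comm' (t' := univ) (s' := fun j => Ioi j) (by simp)]
    exact sum_congr rfl fun i _ => sum_congr rfl fun j _ => hsymm j i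
  rw [h2]
  ring

variable {X : Type*} {d : X → X → ℝ} {p : ℝ}

@[simp]
theorem powDist_self (d : X → X → ℝ) (p : ℝ) (x : X) : powDist d p x x = 0 := by
  simp [powDist]

theorem powDist_comm (hd : ∀ x y, d x y = d y x) (p : ℝ) (x y : X) :
    powDist d p x y = powDist d p y x := by
  by_cases h : x = y
  · rw [h]
  · rw [powDist, powDist, if_neg h, if_neg (Ne.symm h), hd]

namespace SignedSimplex

theorem sum_netWeight_mul (Q : SignedSimplex X) (S : Finset X) (hx : ∀ i, Q.x i ∈ S)
    (hy : ∀ j, Q.y j ∈ S) (f : X → ℝ) :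
    ∑ z ∈ S, Q.netWeight z * f z = ∑ i, Q.m i * f (Q.x i) - ∑ j, Q.n j * f (Q.y j) := by
  classical
  simp only [netWeight, sub_mul, sum_sub_distrib, sum_mul]
  congr 1
  · rw [sum_comm]
    refine sum_congr rfl fun i _ => ?_
    simp [ite_mul, hx i]
  · rw [sum_comm]
    refine sum_congr rfl fun i _ => ?_
    simp [ite_mul, hy i]

/-- The net weight is a signed measure `∑ m_i δ_{x_i} - ∑ n_j δ_{y_j}`. Expanding its quadratic form
gives the two one-sided double sums, each counted twice, minus twice the mixed sum. -/
theorem gap_eq (hd : ∀ x y, d x y = d y x) (Q : SignedSimplex X) (S : Finset X)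
    (hx : ∀ i, Q.x i ∈ S) (hy : ∀ j, Q.y j ∈ S) :
    Q.gap d p
      = -(1 / 2) * ∑ z ∈ S, ∑ w ∈ S, powDist d p z w * Q.netWeight z * Q.netWeight w := by
  have h1 : ∑ z ∈ S, ∑ w ∈ S, powDist d p z w * Q.netWeight z * Q.netWeight w
      = ∑ i, ∑ i', Q.m i * Q.m i' * powDist d p (Q.x i) (Q.x i')
        + ∑ j, ∑ j', Q.n j * Q.n j' * powDist d p (Q.y j) (Q.y j')
        - 2 * ∑ i, ∑ j, Q.m i * Q.n j * powDist d p (Q.x i) (Q.y j) := by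
    have e1 : ∀ z, ∑ w ∈ S, powDist d p z w * Q.netWeight z * Q.netWeight w
        = Q.netWeight z * (∑ i, Q.m i * powDist d p z (Q.x i)
          - ∑ j, Q.n j * powDist d p z (Q.y j)) := by
      intro z
      rw [← Q.sum_netWeight_mul S hx hy, mul_sum]
      exact sum_congr rfl fun w _ => by ring
    simp_rw [e1]
    rw [Q.sum_netWeight_mul S hx hy]
    simp only [mul_sub, sum_sub_distrib, mul_sum]
    have e2 : ∑ j, ∑ i, Q.n j * (Q.m i * powDist d p (Q.y j) (Q.x i))
        = ∑ i, ∑ j, Q.m i * (Q.n j * powDist d p (Q.x i) (Q.y j)) := by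
      rw [sum_comm]
      refine sum_congr rfl fun i _ => sum_congr rfl fun j _ => ?_
      rw [powDist_comm hd]
      ring
    rw [e2]
    simp only [← mul_sum, mul_assoc]
    ring
  rw [h1, Fin.sum_sum_eq_two_mul_sum_Ioi _ _ _, Fin.sum_sum_eq_two_mul_sum_Ioi _ _ _, gap]
  · ring
  · intro i j
    rw [powDist_comm hd]
    ring
  · simp
  · intro i j
    rw [powDist_comm hd]
    ring
  · simp

theorem CompletelyRefined.netWeight_ne_zero {R : SignedSimplex X} (hR : R.CompletelyRefined) :
    R.netWeight (R.x ⟨0, hR.s_pos⟩) ≠ 0 := by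
  classical
  have h1 : R.netWeight (R.x ⟨0, hR.s_pos⟩) = R.m ⟨0, hR.s_pos⟩ := by
    simp only [netWeight, hR.x_injective.eq_iff]
    rw [sum_eq_zero (s := (univ : Finset (Fin R.t)))
      (fun j _ => if_neg fun h => hR.x_ne_y _ j h.symm)]
    simp
  rw [h1]
  exact (hR.m_pos _).ne'

end SignedSimplex

/-- For the discrete metric the form is `(∑ ξ)² - ∑ ξ²`, which is `-∑ ξ²` at weights of sum zero. -/
theorem not_hasNontrivialPolygonalEquality_zero (hd : ∀ x y, d x y = d y x) :
    ¬ HasNontrivialPolygonalEquality d 0 := by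
  classical
  rintro ⟨Q, ⟨R, hR, hQR⟩, h0⟩
  set S : Finset X := univ.image Q.x ∪ univ.image Q.y with hS
  have hx : ∀ i, Q.x i ∈ S := fun i => by simp [hS]
  have hy : ∀ i, Q.y i ∈ S := fun i => by simp [hS]
  rw [Q.gap_eq hd S hx hy] at h0
  have htot : ∑ z ∈ S, Q.netWeight z = 0 := by
    have := Q.sum_netWeight_mul S hx hy fun _ => 1
    simpa [Q.balanced] using this
  have hrow : ∀ z ∈ S, ∑ w ∈ S, powDist d 0 z w * Q.netWeight z * Q.netWeight w
      = - Q.netWeight z ^ 2 := by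
    intro z hz
    have e : ∀ w, powDist d 0 z w * Q.netWeight z * Q.netWeight w
        = Q.netWeight z * Q.netWeight w - if z = w then Q.netWeight z ^ 2 else 0 := by
      intro w
      by_cases h : z = w
      · subst h; simp [powDist]; ring
      · simp [powDist, h]
    simp_rw [e, sum_sub_distrib, ← mul_sum, htot]
    simp [hz]
  rw [sum_congr rfl hrow, sum_neg_distrib] at h0
  have h1 : ∑ z ∈ S, Q.netWeight z ^ 2 = 0 := by linarith
  rw [sum_eq_zero_iff_of_nonneg fun _ _ => sq_nonneg _] at h1
  have hne := hR.netWeight_ne_zero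
  rw [← hQR] at hne
  set z := R.x ⟨0, hR.s_pos⟩
  by_cases hz : z ∈ S
  · exact hne (by simpa using h1 z hz)
  · refine hne ?_
    simp only [SignedSimplex.netWeight]
    rw [sum_eq_zero fun i _ => if_neg ?_, sum_eq_zero fun i _ => if_neg ?_, sub_zero]
    · exact fun h => hz (h ▸ hy i)
    · exact fun h => hz (h ▸ hx i)

/-- A nonzero weight with sum zero at which the quadratic form of the `p`-distance matrix vanishes
gives a nontrivial `p`-polygonal equality. -/
theorem hasNontrivialPolygonalEquality_of_isotropic (hd : ∀ x y, d x y = d y x) (S : Finset X)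
    (ξ : X → ℝ) (hsum : ∑ x ∈ S, ξ x = 0) (hne : ∃ x ∈ S, ξ x ≠ 0)
    (hform : ∑ x ∈ S, ∑ y ∈ S, powDist d p x y * ξ x * ξ y = 0) :
    HasNontrivialPolygonalEquality d p := by
  classical
  -- Points of positive weight go to the left, points of negative weight to the right with the sign
  -- reversed; since the total is zero and some weight is nonzero, both sides are nonempty.
  set A := S.filter fun x => 0 < ξ x with hA
  set B := S.filter fun x => ξ x < 0 with hB
  have hsplit : ∀ f : X → ℝ, ∑ x ∈ S, ξ x * f x = ∑ x ∈ A, ξ x * f x + ∑ x ∈ B, ξ x * f x := by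
    intro f
    have h1 : B = (S.filter fun x => ¬ 0 < ξ x).filter fun x => ξ x ≠ 0 := by
      ext x
      simp only [hB, mem_filter, not_lt, and_assoc]
      refine and_congr_right fun _ => ⟨fun h => ⟨h.le, h.ne⟩, fun h => lt_of_le_of_ne h.1 h.2⟩
    rw [← sum_filter_add_sum_filter_not S (fun x => 0 < ξ x), h1]
    congr 1
    refine (sum_filter_of_ne (p := fun x => ξ x ≠ 0) fun x _ hx h => hx ?_).symm
    rw [h, zero_mul]
  have hbal : ∑ x ∈ A, ξ x = ∑ x ∈ B, -ξ x := by
    have := hsplit fun _ => 1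
    simp only [mul_one, hsum] at this
    rw [sum_neg_distrib]
    linarith
  have hAne : 0 < A.card ∧ 0 < B.card := by
    have hor : A.Nonempty ∨ B.Nonempty := by
      obtain ⟨x, hx, hx0⟩ := hne
      rcases lt_or_gt_of_ne hx0 with h | h
      · exact Or.inr ⟨x, by simp [hB, hx, h]⟩
      · exact Or.inl ⟨x, by simp [hA, hx, h]⟩
    have hApos : A.Nonempty → 0 < ∑ x ∈ A, ξ x := fun h =>
      sum_pos (fun x hx => (mem_filter.1 hx).2) h
    have hBpos : B.Nonempty → 0 < ∑ x ∈ B, -ξ x := fun h =>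
      sum_pos (fun x hx => neg_pos.2 (mem_filter.1 hx).2) h
    rw [card_pos, card_pos]
    by_contra hcon
    rcases hor with h | h
    · have hBe : B = ∅ := not_nonempty_iff_eq_empty.1 fun h' => hcon ⟨h, h'⟩
      have := hApos h
      rw [hbal, hBe] at this
      simp at this
    · have hAe : A = ∅ := not_nonempty_iff_eq_empty.1 fun h' => hcon ⟨h', h⟩
      have := hBpos h
      rw [← hbal, hAe] at this
      simp at this
  let x : Fin A.card → X := fun i => A.equivFin.symm i
  let y : Fin B.card → X := fun i => B.equivFin.symm i
  have hsumA : ∀ f : X → ℝ, ∑ i, f (x i) = ∑ a ∈ A, f a := fun f => by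
    rw [← sum_coe_sort A]
    exact A.equivFin.symm.sum_comp fun a => f a
  have hsumB : ∀ f : X → ℝ, ∑ i, f (y i) = ∑ a ∈ B, f a := fun f => by
    rw [← sum_coe_sort B]
    exact B.equivFin.symm.sum_comp fun a => f a
  have hxA : ∀ i, x i ∈ A := fun i => (A.equivFin.symm i).2
  have hyB : ∀ i, y i ∈ B := fun i => (B.equivFin.symm i).2
  let Q : SignedSimplex X :=
    { s := A.card
      t := B.card
      x := x
      y := y
      m := fun i => ξ (x i)
      n := fun i => -ξ (y i)
      balanced := by rw [hsumA ξ, hsumB fun z => -ξ z, hbal] }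
  have hQ : Q.CompletelyRefined :=
    { s_pos := hAne.1
      t_pos := hAne.2
      x_injective := Subtype.val_injective.comp A.equivFin.symm.injective
      y_injective := Subtype.val_injective.comp B.equivFin.symm.injective
      x_ne_y := fun i j h => by
        have h1 := (mem_filter.1 (hxA i)).2
        have h2 := (mem_filter.1 (hyB j)).2
        have h3 : x i = y j := h
        rw [h3] at h1
        exact lt_asymm h1 h2
      m_pos := fun i => (mem_filter.1 (hxA i)).2
      n_pos := fun i => neg_pos.2 (mem_filter.1 (hyB i)).2 }
  refine ⟨Q, ⟨Q, hQ, fun _ => rfl⟩, ?_⟩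
  have hnet : ∀ f : X → ℝ, ∑ z ∈ S, Q.netWeight z * f z = ∑ z ∈ S, ξ z * f z := by
    intro f
    rw [Q.sum_netWeight_mul S (fun i => (mem_filter.1 (hxA i)).1)
      (fun i => (mem_filter.1 (hyB i)).1), hsplit]
    have e1 : ∑ i, Q.m i * f (Q.x i) = ∑ a ∈ A, ξ a * f a := hsumA fun z => ξ z * f z
    have e2 : ∑ i, Q.n i * f (Q.y i) = ∑ a ∈ B, -ξ a * f a := hsumB fun z => -ξ z * f z
    rw [e1, e2]
    simp
  rw [Q.gap_eq hd S (fun i => (mem_filter.1 (hxA i)).1) (fun i => (mem_filter.1 (hyB i)).1)]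
  have e3 : ∑ z ∈ S, ∑ w ∈ S, powDist d p z w * Q.netWeight z * Q.netWeight w
      = ∑ z ∈ S, ∑ w ∈ S, powDist d p z w * ξ z * ξ w := by
    calc _ = ∑ z ∈ S, Q.netWeight z * ∑ w ∈ S, Q.netWeight w * powDist d p z w := by
          refine sum_congr rfl fun z _ => ?_
          rw [mul_sum]
          exact sum_congr rfl fun w _ => by ring
      _ = ∑ z ∈ S, ξ z * ∑ w ∈ S, ξ w * powDist d p z w := by
          rw [hnet fun z => ∑ w ∈ S, Q.netWeight w * powDist d p z w]
          exact sum_congr rfl fun z _ => by rw [hnet]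
      _ = _ := by
          refine sum_congr rfl fun z _ => ?_
          rw [mul_sum]
          exact sum_congr rfl fun w _ => by ring
  rw [e3, hform, mul_zero]

/-- Intermediate value theorem on the segment from a vector where the form is positive to `δ_a -
δ_b`, where it equals `-2 d(a, b)^p < 0`. -/
theorem hasNontrivialPolygonalEquality_of_not_isNegativeType (hd : ∀ x y, d x y = d y x)
    {a b : X} (hab : a ≠ b) (hpos : 0 < d a b) (h : ¬ IsNegativeType d p) :
    HasNontrivialPolygonalEquality d p := by
  classical
  simp only [IsNegativeType, not_forall, not_le] at h
  obtain ⟨S₀, ξ₀, hsum₀, hform₀⟩ := h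
  set S := S₀ ∪ {a, b} with hS
  set ξ : X → ℝ := fun x => if x ∈ S₀ then ξ₀ x else 0 with hξ
  have hres : ∀ f : X → ℝ, ∑ x ∈ S, ξ x * f x = ∑ x ∈ S₀, ξ₀ x * f x := by
    intro f
    rw [← sum_subset (subset_union_left : S₀ ⊆ S) (fun x _ hx => by simp [hξ, hx])]
    exact sum_congr rfl fun x hx => by simp [hξ, hx]
  set η : X → ℝ := fun x => (if x = a then 1 else 0) - if x = b then 1 else 0 with hη
  have haS : a ∈ S := by simp [hS]
  have hbS : b ∈ S := by simp [hS]
  have hres' : ∀ f : X → ℝ, ∑ x ∈ S, η x * f x = f a - f b := by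
    intro f
    simp [hη, sub_mul, sum_sub_distrib, haS, hbS]
  let F : (X → ℝ) → ℝ := fun ζ => ∑ x ∈ S, ζ x * ∑ y ∈ S, ζ y * powDist d p x y
  have hF : ∀ ζ, F ζ = ∑ x ∈ S, ∑ y ∈ S, powDist d p x y * ζ x * ζ y := by
    intro ζ
    refine sum_congr rfl fun z _ => ?_
    rw [mul_sum]
    exact sum_congr rfl fun w _ => by ring
  have hFξ : 0 < F ξ := by
    have : F ξ = ∑ x ∈ S₀, ∑ y ∈ S₀, powDist d p x y * ξ₀ x * ξ₀ y := by
      simp only [F]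
      rw [hres fun x => ∑ y ∈ S, ξ y * powDist d p x y]
      refine sum_congr rfl fun z _ => ?_
      rw [hres, mul_sum]
      exact sum_congr rfl fun w _ => by ring
    rw [this]
    exact hform₀
  have hFη : F η < 0 := by
    have : F η = -2 * d a b ^ p := by
      simp only [F]
      rw [hres' fun x => ∑ y ∈ S, η y * powDist d p x y, hres', hres']
      simp only [powDist_self]
      rw [powDist_comm hd p b a]
      simp only [powDist, if_neg hab]
      ring
    rw [this]
    have := Real.rpow_pos_of_pos hpos p
    linarith
  have hsumξ : ∑ x ∈ S, ξ x = 0 := by simpa [hsum₀] using hres fun _ => 1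
  have hsumη : ∑ x ∈ S, η x = 0 := by simpa using hres' fun _ => 1
  have hcont : Continuous fun t : ℝ => F fun x => (1 - t) * ξ x + t * η x := by
    simp only [F]
    fun_prop
  obtain ⟨t, ht, ht0⟩ : (0 : ℝ) ∈ (fun t : ℝ => F fun x => (1 - t) * ξ x + t * η x) ''
      Set.Icc 0 1 := by
    refine intermediate_value_Icc' zero_le_one hcont.continuousOn ⟨?_, ?_⟩
    · simpa using hFη.le
    · simpa using hFξ.le
  refine hasNontrivialPolygonalEquality_of_isotropic hd S _ ?_ ?_ ((hF _).symm.trans ht0)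
  · rw [sum_add_distrib, ← mul_sum, ← mul_sum, hsumξ, hsumη]
    simp
  · by_contra hcon
    push Not at hcon
    -- If the interpolated vector vanished, `t η` and `-(1 - t) ξ` would agree on `S` and give the
    -- form the same value. As `F η < 0 < F ξ`, this forces `t = 0`, and then `F ξ = 0`.
    have hη' : t ^ 2 * F η = (1 - t) ^ 2 * F ξ := by
      simp only [F, mul_sum]
      refine sum_congr rfl fun x hx => sum_congr rfl fun y hy => ?_
      have h1 : t * η x = -((1 - t) * ξ x) := by linarith [hcon x hx]
      have h2 : t * η y = -((1 - t) * ξ y) := by linarith [hcon y hy]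
      linear_combination (powDist d p x y * (t * η y)) * h1
        - (powDist d p x y * ((1 - t) * ξ x)) * h2
    have h3 : t = 0 := by
      by_contra h
      have : 0 < t ^ 2 := by positivity
      nlinarith [sq_nonneg (1 - t)]
    rw [h3] at hη'
    norm_num at hη'
    exact hFξ.ne' hη'.symm

theorem not_isNegativeType_of_supremalNegativeType_eq_zero (h : supremalNegativeType d = 0)
    (hp : 0 < p) : ¬ IsNegativeType d p := by
  intro hneg
  have h1 : ENNReal.ofReal p ≤ supremalNegativeType d :=
    le_iSup₂ (f := fun (p : ℝ) (_ : p ∈ {p : ℝ | 0 ≤ p ∧ IsNegativeType d p}) => ENNReal.ofReal p)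
      p ⟨hp.le, hneg⟩
  rw [h, nonpos_iff_eq_zero, ENNReal.ofReal_eq_zero] at h1
  exact absurd hp (not_lt.2 h1)

theorem supremalNegativeType_eq_zero (h : ∀ p : ℝ, 0 < p → ¬ IsNegativeType d p) :
    supremalNegativeType d = 0 := by
  refine le_antisymm (iSup₂_le fun p hp => ?_) zero_le
  rw [ENNReal.ofReal_eq_zero.2]
  by_contra hcon
  exact h p (not_le.1 hcon) hp.2

theorem polygonalSet_eq_Ioi (hd : ∀ x y, d x y = d y x) {a b : X} (hab : a ≠ b)
    (hpos : 0 < d a b) (h : ∀ p : ℝ, 0 < p → ¬ IsNegativeType d p) :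
    polygonalSet d = Set.Ioi 0 := by
  ext p
  refine ⟨fun hp => lt_of_le_of_ne hp.1 ?_, fun hp => ⟨le_of_lt hp, ?_⟩⟩
  · rintro rfl
    exact not_hasNontrivialPolygonalEquality_zero hd hp.2
  · exact hasNontrivialPolygonalEquality_of_not_isNegativeType hd hab hpos (h p hp)

theorem polygonalSet_dist_eq_Ioi (X : Type*) [MetricSpace X]
    (h : supremalNegativeType (dist : X → X → ℝ) = 0) :
    polygonalSet (dist : X → X → ℝ) = Set.Ioi 0 := by
  have hneg : ∀ p : ℝ, 0 < p → ¬ IsNegativeType (dist : X → X → ℝ) p := fun p hp =>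
    not_isNegativeType_of_supremalNegativeType_eq_zero h hp
  rcases subsingleton_or_nontrivial X with hX | hX
  -- A space with at most one point is of `1`-negative type, so it is excluded by the hypothesis.
  · refine absurd ?_ (hneg 1 one_pos)
    intro S ξ _
    refine (sum_eq_zero fun x _ => sum_eq_zero fun y _ => ?_).le
    rw [Subsingleton.elim x y, powDist_self]
    ring
  · obtain ⟨a, b, hab⟩ := exists_pair_ne X
    exact polygonalSet_eq_Ioi dist_comm hab (dist_pos.2 hab) hneg

end PolygonalEqualities

/-! ### Positive definite functions and Gaussian measures -/

section PositiveDefinite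

open MeasureTheory ProbabilityTheory Filter Topology
open scoped RealInnerProductSpace

/-- If all finite sections of a kernel have nonnegative total sum, then so has its integral. -/
theorem integral_prod_nonneg_of_sum_nonneg {Ω : Type*} [MeasurableSpace Ω] (ρ : Measure Ω)
    [IsProbabilityMeasure ρ] {k : Ω × Ω → ℝ} (hk : Integrable k (ρ.prod ρ))
    (hdiag : Integrable (fun ω => k (ω, ω)) ρ)
    (h : ∀ (n : ℕ) (ω : Fin n → Ω), 0 ≤ ∑ i, ∑ j, k (ω i, ω j)) :
    0 ≤ ∫ z, k z ∂ρ.prod ρ := by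
  have hpair : ∀ n : ℕ, ∀ i j : Fin n, i ≠ j →
      (Measure.pi fun _ : Fin n => ρ).map (fun ω => (ω i, ω j)) = ρ.prod ρ := by
    intro n i j hij
    have hind : IndepFun (fun ω : Fin n → Ω => ω i) (fun ω => ω j)
        (Measure.pi fun _ : Fin n => ρ) :=
      (iIndepFun_pi (μ := fun _ : Fin n => ρ) (X := fun _ => id)
        fun _ => aemeasurable_id).indepFun hij
    rw [(indepFun_iff_map_prod_eq_prod_map_map (measurable_pi_apply i).aemeasurable
      (measurable_pi_apply j).aemeasurable).1 hind,
      (measurePreserving_eval (fun _ : Fin n => ρ) i).map_eq,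
      (measurePreserving_eval (fun _ : Fin n => ρ) j).map_eq]
  set I := ∫ z, k z ∂ρ.prod ρ with hI
  set D := ∫ ω, k (ω, ω) ∂ρ with hD
  have hterm : ∀ n : ℕ, ∀ i j : Fin n,
      Integrable (fun ω : Fin n → Ω => k (ω i, ω j)) (Measure.pi fun _ => ρ) ∧
      ∫ ω : Fin n → Ω, k (ω i, ω j) ∂(Measure.pi fun _ => ρ) = if i = j then D else I := by
    intro n i j
    by_cases hij : i = j
    · subst hij
      have hm := measurePreserving_eval (fun _ : Fin n => ρ) i
      simp only [if_true]
      refine ⟨hm.integrable_comp_of_integrable hdiag, ?_⟩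
      rw [hD]
      conv_rhs => rw [← hm.map_eq]
      rw [integral_map hm.measurable.aemeasurable]
      rw [hm.map_eq]
      exact hdiag.aestronglyMeasurable
    · simp only [if_neg hij]
      have hm : MeasurePreserving (fun ω : Fin n → Ω => (ω i, ω j)) (Measure.pi fun _ => ρ)
          (ρ.prod ρ) := ⟨by fun_prop, hpair n i j hij⟩
      refine ⟨hm.integrable_comp_of_integrable hk, ?_⟩
      rw [hI]
      conv_rhs => rw [← hm.map_eq]
      rw [integral_map hm.measurable.aemeasurable]
      rw [hm.map_eq]
      exact hk.aestronglyMeasurable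
  -- Integrate the hypothesis over `n` independent samples: the `n` diagonal terms contribute `D`
  -- each, the `n (n - 1)` others `I` each. If `I` were negative, the quadratic term would win for
  -- large `n`.
  have hineq : ∀ n : ℕ, 0 ≤ (n : ℝ) * D + n * (n - 1) * I := by
    intro n
    have h0 : 0 ≤ ∫ ω : Fin n → Ω, ∑ i, ∑ j, k (ω i, ω j) ∂(Measure.pi fun _ => ρ) :=
      integral_nonneg fun ω => h n ω
    rw [integral_finsetSum _ fun i _ => integrable_finsetSum _ fun j _ => (hterm n i j).1] at h0
    simp_rw [integral_finsetSum _ fun j _ => (hterm n _ j).1, (hterm n _ _).2] at h0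
    have e : ∀ i j : Fin n, (if i = j then D else I) = I + if i = j then D - I else 0 := by
      intro i j
      split_ifs <;> ring
    simp_rw [e, Finset.sum_add_distrib] at h0
    simp only [Finset.sum_const, Finset.card_univ, Fintype.card_fin, nsmul_eq_mul,
      Finset.sum_ite_eq, Finset.mem_univ, if_true] at h0
    linarith
  by_contra hneg
  push Not at hneg
  obtain ⟨n, hn⟩ := exists_nat_gt (1 + |D| / (-I))
  have h1 : |D| < (n - 1) * (-I) := by
    have : |D| / (-I) < n - 1 := by linarith
    rwa [div_lt_iff₀ (by linarith)] at this
  have hnpos : (0 : ℝ) < n := by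
    have : 0 ≤ |D| / (-I) := div_nonneg (abs_nonneg _) (by linarith)
    linarith
  have h2 := hineq n
  have h3 : 0 ≤ D + (n - 1) * I := by
    by_contra hc
    push Not at hc
    nlinarith
  linarith [le_abs_self D]

variable {E : Type*} [NormedAddCommGroup E]

/-- A real function on a vector space is positive definite. -/
structure IsPosDefFun (φ : E → ℝ) : Prop where
  even : ∀ x, φ (-x) = φ x
  sum_nonneg : ∀ (n : ℕ) (s : Fin n → E) (ξ : Fin n → ℝ),
    0 ≤ ∑ i, ∑ j, ξ i * ξ j * φ (s i - s j)

/-- Use the two points `x, 0` with weights `1, 1` and `1, -1`. -/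
theorem IsPosDefFun.abs_le {φ : E → ℝ} (h : IsPosDefFun φ) (x : E) : |φ x| ≤ φ 0 := by
  have h1 := h.sum_nonneg 2 ![x, 0] ![1, 1]
  have h2 := h.sum_nonneg 2 ![x, 0] ![1, -1]
  simp [Fin.sum_univ_two, h.even] at h1 h2
  rw [_root_.abs_le]
  constructor <;> linarith

variable [InnerProductSpace ℝ E] [FiniteDimensional ℝ E] [MeasurableSpace E] [BorelSpace E]

theorem integral_cos_inner (μ : Measure E) [IsFiniteMeasure μ] (x : E) :
    ∫ y, Real.cos ⟪y, x⟫ ∂μ = (charFun μ x).re := by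
  rw [charFun_apply, ← RCLike.re_eq_complex_re, ← integral_re]
  · refine integral_congr_ae (Eventually.of_forall fun y => ?_)
    simp [Complex.exp_ofReal_mul_I_re]
  · refine Integrable.of_bound (by fun_prop) 1 (Eventually.of_forall fun y => ?_)
    rw [Complex.norm_exp_ofReal_mul_I]

theorem charFun_map_sub (μ ν : Measure E) [IsFiniteMeasure μ] [IsFiniteMeasure ν] (t : E) :
    charFun ((μ.prod ν).map fun z => z.1 - z.2) t = charFun μ t * charFun ν (-t) := by
  rw [charFun_apply, integral_map (by fun_prop) (by fun_prop)]
  simp only [charFun_apply]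
  rw [← integral_prod_mul (μ := μ) (ν := ν)]
  refine integral_congr_ae (Eventually.of_forall fun z => ?_)
  simp only
  rw [← Complex.exp_add, inner_sub_left, inner_neg_right]
  congr 1
  push_cast
  ring

theorem stdGaussian_map_neg :
    (stdGaussian E).map (fun x => -x) = stdGaussian E := by
  have := stdGaussian_map (E := E) (LinearIsometryEquiv.neg ℝ)
  exact this

theorem stdGaussian_map_sub :
    ((stdGaussian E).prod (stdGaussian E)).map (fun z => z.1 - z.2)
      = (stdGaussian E).map fun x => √2 • x := by
  have : IsProbabilityMeasure ((stdGaussian E).map fun x => √2 • x) :=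
    Measure.isProbabilityMeasure_map (by fun_prop)
  have : IsProbabilityMeasure (((stdGaussian E).prod (stdGaussian E)).map fun z => z.1 - z.2) :=
    Measure.isProbabilityMeasure_map (by fun_prop)
  refine Measure.ext_of_charFun (funext fun t => ?_)
  rw [charFun_map_sub, charFun_map_smul, charFun_stdGaussian, charFun_stdGaussian,
    charFun_stdGaussian, norm_neg, norm_smul, ← Complex.exp_add]
  congr 1
  have h2 : ((√2 : ℝ) : ℂ) ^ 2 = 2 := by
    rw [← Complex.ofReal_pow, Real.sq_sqrt (by norm_num)]
    norm_num
  rw [Real.norm_of_nonneg (Real.sqrt_nonneg 2), Complex.ofReal_mul, mul_pow, h2]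
  ring

theorem integral_cos_stdGaussian (x : E) :
    ∫ y, Real.cos ⟪y, x⟫ ∂stdGaussian E = Real.exp (-‖x‖ ^ 2 / 2) := by
  rw [integral_cos_inner, charFun_stdGaussian]
  norm_cast

/-- The explicit density is what permits the linear change of variables in
`IsPosDefFun.gaussianSmoothing_eq`. -/
theorem stdGaussian_eq_withDensity :
    stdGaussian E = (volume : Measure E).withDensity fun x =>
      ENNReal.ofReal ((2 * Real.pi) ^ (-(Module.finrank ℝ E / 2 : ℝ)) * Real.exp (-‖x‖ ^ 2 / 2)) := by
  set c : ℝ := (2 * Real.pi) ^ (-(Module.finrank ℝ E / 2 : ℝ)) with hc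
  have hcpos : 0 < c := Real.rpow_pos_of_pos (by positivity) _
  have hint : Integrable (fun x : E => c * Real.exp (-‖x‖ ^ 2 / 2)) := by
    have := (GaussianFourier.integrable_cexp_neg_mul_sq_norm_add (V := E) (b := (1 / 2 : ℂ))
      (by norm_num) 0 0).re
    refine Integrable.const_mul (this.congr (Eventually.of_forall fun x => ?_)) c
    simp only [inner_zero_left, Complex.ofReal_zero, mul_zero, add_zero, RCLike.re_eq_complex_re]
    rw [show (-(1 / 2 : ℂ) * (‖x‖ : ℂ) ^ 2) = ((-‖x‖ ^ 2 / 2 : ℝ) : ℂ) by push_cast; ring,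
      Complex.exp_ofReal_re]
  have : IsFiniteMeasure ((volume : Measure E).withDensity fun x =>
      ENNReal.ofReal (c * Real.exp (-‖x‖ ^ 2 / 2))) :=
    isFiniteMeasure_withDensity_ofReal hint.2
  refine Measure.ext_of_charFun (funext fun t => ?_)
  rw [charFun_stdGaussian, charFun_apply, integral_withDensity_eq_integral_toReal_smul
    (by fun_prop) (by simp)]
  have e1 : ∀ x : E, (ENNReal.ofReal (c * Real.exp (-‖x‖ ^ 2 / 2))).toReal
      • Complex.exp (⟪x, t⟫ * Complex.I)
      = (c : ℂ) * Complex.exp (-(1 / 2 : ℂ) * (‖x‖ : ℂ) ^ 2 + Complex.I * ⟪t, x⟫) := by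
    intro x
    rw [ENNReal.toReal_ofReal (by positivity), Complex.real_smul, real_inner_comm, Complex.exp_add]
    push_cast
    rw [mul_assoc]
    congr 3
    · ring
    · ring
  simp_rw [e1]
  rw [integral_const_mul, GaussianFourier.integral_cexp_neg_mul_sq_norm_add (by norm_num)]
  have e2 : ((Real.pi : ℂ) / (1 / 2 : ℂ)) ^ (Module.finrank ℝ E / 2 : ℂ)
      = (((2 * Real.pi) ^ (Module.finrank ℝ E / 2 : ℝ) : ℝ) : ℂ) := by
    rw [Complex.ofReal_cpow (by positivity)]
    push_cast
    congr 1
    ring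
  rw [e2, ← mul_assoc, ← Complex.ofReal_mul, hc, ← Real.rpow_add (by positivity)]
  simp only [neg_add_cancel, Real.rpow_zero, Complex.ofReal_one, one_mul, Complex.I_sq]
  congr 1
  ring

theorem integral_stdGaussian_eq (f : E → ℝ) :
    ∫ x, f x ∂stdGaussian E = (2 * Real.pi) ^ (-(Module.finrank ℝ E / 2 : ℝ))
      * ∫ x, f x * Real.exp (-‖x‖ ^ 2 / 2) := by
  rw [stdGaussian_eq_withDensity, integral_withDensity_eq_integral_toReal_smul
    (by fun_prop) (by simp), ← integral_const_mul]
  refine integral_congr_ae (Eventually.of_forall fun x => ?_)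
  simp only [smul_eq_mul]
  rw [ENNReal.toReal_ofReal (by positivity)]
  ring

end PositiveDefinite

/-! ### Positive definite functions tested against measures with nonnegative Fourier transform -/

section Smoothing

open MeasureTheory ProbabilityTheory Filter Topology
open scoped RealInnerProductSpace

variable {E : Type*} [NormedAddCommGroup E] [InnerProductSpace ℝ E] [FiniteDimensional ℝ E]
  [MeasurableSpace E] [BorelSpace E] {φ : E → ℝ}

theorem integrable_of_continuous_of_abs_le {F : Type*} [TopologicalSpace F]
    [MeasurableSpace F] [OpensMeasurableSpace F] {μ : Measure F} [IsFiniteMeasure μ] {f : F → ℝ}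
    (hf : Continuous f) {C : ℝ} (hC : ∀ x, |f x| ≤ C) : Integrable f μ :=
  Integrable.of_bound hf.measurable.aestronglyMeasurable C (Eventually.of_forall hC)

theorem abs_mul_le_of_abs_le {a b C : ℝ} (ha : |a| ≤ C) (hb : |b| ≤ 1) : |a * b| ≤ C := by
  rw [abs_mul]
  calc |a| * |b| ≤ C * 1 := mul_le_mul ha hb (abs_nonneg _) ((abs_nonneg _).trans ha)
    _ = C := mul_one C

theorem abs_exp_neg_sq_le (a : ℝ) : |Real.exp (-a ^ 2 / 2)| ≤ 1 := by
  rw [abs_of_pos (Real.exp_pos _), Real.exp_le_one_iff]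
  linarith [sq_nonneg a]

/-- The Gaussian-weighted Fourier transform of a positive definite function is nonnegative. -/
theorem IsPosDefFun.integral_mul_cos_nonneg (h : IsPosDefFun φ) (hc : Continuous φ) (a : ℝ)
    (x : E) : 0 ≤ ∫ y, φ (a • y) * Real.cos ⟪a • y, x⟫ ∂stdGaussian E := by
  -- The difference of two independent standard Gaussians is distributed as `√2` times one, so `a •
  -- y` can be replaced by `b • (y₁ - y₂)`, which makes the integrand a kernel on pairs.
  set b := a / √2 with hb
  have hab : ∀ y : E, b • √2 • y = a • y := by
    intro y
    rw [smul_smul, hb, div_mul_cancel₀ _ (by positivity)]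
  have hbd : ∀ y : E, |φ (b • y) * Real.cos ⟪b • y, x⟫| ≤ φ 0 := fun y =>
    abs_mul_le_of_abs_le (h.abs_le _) (Real.abs_cos_le_one _)
  have key := integral_prod_nonneg_of_sum_nonneg (stdGaussian E)
    (k := fun z : E × E => φ (b • (z.1 - z.2)) * Real.cos ⟪b • (z.1 - z.2), x⟫)
    (integrable_of_continuous_of_abs_le (by fun_prop) (fun z => hbd (z.1 - z.2)))
    (by simp) ?_
  · have e1 : ∫ z : E × E, φ (b • (z.1 - z.2)) * Real.cos ⟪b • (z.1 - z.2), x⟫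
          ∂(stdGaussian E).prod (stdGaussian E)
        = ∫ y, φ (b • y) * Real.cos ⟪b • y, x⟫
          ∂((stdGaussian E).prod (stdGaussian E)).map (fun z => z.1 - z.2) := by
      rw [integral_map (by fun_prop)
        (Continuous.measurable (by fun_prop)).aestronglyMeasurable]
    rw [e1, stdGaussian_map_sub, integral_map (by fun_prop)
      (Continuous.measurable (by fun_prop)).aestronglyMeasurable] at key
    simpa only [hab] using key
  · intro n ω
    -- Since `cos (u - v) = cos u cos v + sin u sin v`, the kernel sum splits into two values of the
    -- positive definite form.
    have h1 := h.sum_nonneg n (fun i => b • ω i) fun i => Real.cos ⟪b • ω i, x⟫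
    have h2 := h.sum_nonneg n (fun i => b • ω i) fun i => Real.sin ⟪b • ω i, x⟫
    refine (add_nonneg h1 h2).trans_eq ?_
    simp only [← Finset.sum_add_distrib]
    refine Finset.sum_congr rfl fun i _ => Finset.sum_congr rfl fun j _ => ?_
    rw [smul_sub, inner_sub_left, Real.cos_sub]
    ring

/-- A smoothed version of `φ`, which converges to `φ` as `ν → ∞`. -/
noncomputable def gaussianSmoothing (φ : E → ℝ) (ν : ℝ) (y : E) : ℝ :=
  ∫ b, φ (y + ν⁻¹ • b) * Real.exp (-‖ν⁻¹ • (y + ν⁻¹ • b)‖ ^ 2 / 2) ∂stdGaussian E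

/-- An inversion formula with Gaussian cutoffs: the smoothing is a mixture of the functions `cos ⟪y,
ν x⟫` whose weights are nonnegative by `integral_mul_cos_nonneg`. This replaces the measure of
Bochner's theorem. -/
theorem IsPosDefFun.gaussianSmoothing_eq (h : IsPosDefFun φ) (hc : Continuous φ) {ν : ℝ}
    (hν : 0 < ν) (y : E) :
    gaussianSmoothing φ ν y = (ν ^ 2) ^ Module.finrank ℝ E *
      ∫ x, Real.cos ⟪y, ν • x⟫ *
        ∫ a, φ (ν • a) * Real.cos ⟪ν • a, ν • x⟫ ∂stdGaussian E ∂stdGaussian E := by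
  have hν0 : ν ≠ 0 := hν.ne'
  have hinner : ∀ u : E, ∫ x, Real.cos ⟪u, ν • x⟫ ∂stdGaussian E
      = Real.exp (-‖ν • u‖ ^ 2 / 2) := by
    intro u
    rw [← integral_cos_stdGaussian]
    refine integral_congr_ae (Eventually.of_forall fun x => ?_)
    simp only
    rw [inner_smul_right, inner_smul_right, real_inner_comm]
  have hbd : ∀ y : E, |φ y| ≤ φ 0 := h.abs_le
  -- Fubini: integrating the product of the two cosines over `x` first yields Gaussians centred at
  -- `y` and `-y`. Evenness of `φ` identifies the two contributions.
  have step1 : ∫ x, Real.cos ⟪y, ν • x⟫ *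
        ∫ a, φ (ν • a) * Real.cos ⟪ν • a, ν • x⟫ ∂stdGaussian E ∂stdGaussian E
      = ∫ a, φ (ν • a) * (1 / 2 * (Real.exp (-‖ν • (ν • a - y)‖ ^ 2 / 2)
        + Real.exp (-‖ν • (ν • a + y)‖ ^ 2 / 2))) ∂stdGaussian E := by
    simp_rw [← integral_const_mul]
    rw [integral_integral_swap]
    · refine integral_congr_ae (Eventually.of_forall fun a => ?_)
      simp only
      rw [← hinner, ← hinner, ← integral_add, ← integral_const_mul, ← integral_const_mul]
      · refine integral_congr_ae (Eventually.of_forall fun x => ?_)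
        simp only
        rw [inner_sub_left, inner_add_left, Real.cos_sub, Real.cos_add]
        ring
      · exact integrable_of_continuous_of_abs_le (by fun_prop) fun _ => Real.abs_cos_le_one _
      · exact integrable_of_continuous_of_abs_le (by fun_prop) fun _ => Real.abs_cos_le_one _
    · refine integrable_of_continuous_of_abs_le (C := φ 0) (by fun_prop) fun z => ?_
      rw [Function.uncurry, mul_comm]
      exact abs_mul_le_of_abs_le (abs_mul_le_of_abs_le (hbd _) (Real.abs_cos_le_one _))
        (Real.abs_cos_le_one _)
  have hI : ∀ u : E, Integrable (fun a : E => φ (ν • a) * Real.exp (-‖ν • (ν • a + u)‖ ^ 2 / 2))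
      (stdGaussian E) := fun u =>
    integrable_of_continuous_of_abs_le (by fun_prop) fun a =>
      abs_mul_le_of_abs_le (hbd _) (abs_exp_neg_sq_le _)
  have hI' : Integrable (fun a : E => φ (ν • a) * Real.exp (-‖ν • (ν • a - y)‖ ^ 2 / 2))
      (stdGaussian E) := by simpa only [sub_eq_add_neg] using hI (-y)
  have hsymm : ∫ a, φ (ν • a) * Real.exp (-‖ν • (ν • a + y)‖ ^ 2 / 2) ∂stdGaussian E
      = ∫ a, φ (ν • a) * Real.exp (-‖ν • (ν • a - y)‖ ^ 2 / 2) ∂stdGaussian E := by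
    conv_lhs => rw [← stdGaussian_map_neg]
    rw [integral_map (by fun_prop) (Continuous.measurable (by fun_prop)).aestronglyMeasurable]
    refine integral_congr_ae (Eventually.of_forall fun a => ?_)
    simp only
    rw [smul_neg, h.even, ← norm_neg (ν • (-(ν • a) + y)), ← smul_neg]
    rw [show -(-(ν • a) + y) = ν • a - y by abel]
  have step2 : ∫ a, φ (ν • a) * (1 / 2 * (Real.exp (-‖ν • (ν • a - y)‖ ^ 2 / 2)
        + Real.exp (-‖ν • (ν • a + y)‖ ^ 2 / 2))) ∂stdGaussian E
      = ∫ a, φ (ν • a) * Real.exp (-‖ν • (ν • a - y)‖ ^ 2 / 2) ∂stdGaussian E := by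
    have e : ∀ a : E, φ (ν • a) * (1 / 2 * (Real.exp (-‖ν • (ν • a - y)‖ ^ 2 / 2)
        + Real.exp (-‖ν • (ν • a + y)‖ ^ 2 / 2)))
        = 1 / 2 * (φ (ν • a) * Real.exp (-‖ν • (ν • a - y)‖ ^ 2 / 2)
          + φ (ν • a) * Real.exp (-‖ν • (ν • a + y)‖ ^ 2 / 2)) := fun a => by ring
    simp_rw [e]
    rw [integral_const_mul, integral_add hI' (hI y), hsymm]
    ring
  set F : E → ℝ := fun a => φ (ν • a) * Real.exp (-‖ν • (ν • a - y)‖ ^ 2 / 2)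
    * Real.exp (-‖a‖ ^ 2 / 2) with hF
  -- The substitution `a = ν⁻² b + ν⁻¹ y` gives `ν (ν a - y) = b` and `ν a = y + ν⁻¹ b`; its
  -- Jacobian produces the factor `(ν²) ^ dim E`.
  have hsub : ∫ b : E, F ((ν ^ 2)⁻¹ • b + ν⁻¹ • y)
      = (ν ^ 2) ^ Module.finrank ℝ E * ∫ a : E, F a := by
    rw [Measure.integral_comp_smul volume (fun b : E => F (b + ν⁻¹ • y)),
      integral_add_right_eq_self, smul_eq_mul, inv_pow, inv_inv, abs_of_pos (by positivity)]
  rw [step1, step2, integral_stdGaussian_eq, gaussianSmoothing, integral_stdGaussian_eq,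
    mul_left_comm, ← hsub]
  congr 1
  refine integral_congr_ae (Eventually.of_forall fun b => ?_)
  simp only [hF]
  have e1 : ν • ((ν ^ 2)⁻¹ • b + ν⁻¹ • y) = y + ν⁻¹ • b := by
    rw [smul_add, smul_smul, smul_smul, mul_inv_cancel₀ hν0, one_smul, add_comm]
    congr 2
    field_simp
  have e2 : (ν ^ 2)⁻¹ • b + ν⁻¹ • y = ν⁻¹ • (y + ν⁻¹ • b) := by
    rw [← e1, smul_smul, inv_mul_cancel₀ hν0, one_smul]
  rw [e1, e2, add_sub_cancel_left, smul_smul, mul_inv_cancel₀ hν0, one_smul]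
  ring

theorem IsPosDefFun.abs_gaussianSmoothing_le (h : IsPosDefFun φ) (ν : ℝ) (y : E) :
    |gaussianSmoothing φ ν y| ≤ φ 0 := by
  have := norm_integral_le_of_norm_le_const (μ := stdGaussian E)
    (f := fun b => φ (y + ν⁻¹ • b) * Real.exp (-‖ν⁻¹ • (y + ν⁻¹ • b)‖ ^ 2 / 2)) (C := φ 0)
    (Eventually.of_forall fun b => abs_mul_le_of_abs_le (h.abs_le _) (abs_exp_neg_sq_le _))
  rwa [probReal_univ, mul_one] at this

theorem IsPosDefFun.tendsto_gaussianSmoothing (h : IsPosDefFun φ) (hc : Continuous φ) (y : E) :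
    Tendsto (fun n : ℕ => gaussianSmoothing φ (n : ℝ) y) atTop (𝓝 (φ y)) := by
  have hlim : φ y = ∫ _, φ y ∂stdGaussian E := by simp
  rw [hlim]
  refine tendsto_integral_of_dominated_convergence (fun _ => φ 0) (fun n => ?_)
    (integrable_const _) (fun n => Eventually.of_forall fun b => ?_)
    (Eventually.of_forall fun b => ?_)
  · exact (Continuous.measurable (by fun_prop)).aestronglyMeasurable
  · exact abs_mul_le_of_abs_le (h.abs_le _) (abs_exp_neg_sq_le _)
  · have h0 : Tendsto (fun n : ℕ => ((n : ℝ))⁻¹) atTop (𝓝 0) := tendsto_inv_atTop_nhds_zero_nat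
    have hcont : Continuous fun t : ℝ => φ (y + t • b) * Real.exp (-‖t • (y + t • b)‖ ^ 2 / 2) := by
      fun_prop
    have := (hcont.tendsto 0).comp h0
    simpa [Function.comp_def] using this

theorem IsPosDefFun.integral_gaussianSmoothing (h : IsPosDefFun φ) (hc : Continuous φ) {ν : ℝ}
    (hν : 0 < ν) (μ : Measure E) [IsProbabilityMeasure μ] :
    ∫ y, gaussianSmoothing φ ν y ∂μ = (ν ^ 2) ^ Module.finrank ℝ E *
      ∫ x, (∫ y, Real.cos ⟪y, ν • x⟫ ∂μ) *
        ∫ a, φ (ν • a) * Real.cos ⟪ν • a, ν • x⟫ ∂stdGaussian E ∂stdGaussian E := by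
  have hm : StronglyMeasurable fun x : E =>
      ∫ a, φ (ν • a) * Real.cos ⟪ν • a, ν • x⟫ ∂stdGaussian E := by
    refine StronglyMeasurable.integral_prod_right
      (f := fun x a : E => φ (ν • a) * Real.cos ⟪ν • a, ν • x⟫) ?_
    exact (Continuous.measurable (by fun_prop)).stronglyMeasurable
  simp_rw [h.gaussianSmoothing_eq hc hν]
  rw [integral_const_mul, integral_integral_swap]
  · simp_rw [integral_mul_const]
  · refine Integrable.of_bound (C := φ 0) ?_ (Eventually.of_forall fun z => ?_)
    · refine AEStronglyMeasurable.mul ?_ ?_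
      · exact (Continuous.measurable (by fun_prop)).aestronglyMeasurable
      · exact (hm.comp_measurable measurable_snd).aestronglyMeasurable
    · rw [Function.uncurry, mul_comm]
      refine abs_mul_le_of_abs_le ?_ (Real.abs_cos_le_one _)
      have := norm_integral_le_of_norm_le_const (μ := stdGaussian E)
        (f := fun a => φ (ν • a) * Real.cos ⟪ν • a, ν • z.2⟫) (C := φ 0)
        (Eventually.of_forall fun b =>
          abs_mul_le_of_abs_le (h.abs_le _) (Real.abs_cos_le_one _))
      simpa using this

/-- A linear combination of probability measures whose Fourier transform has nonnegative real part
is nonnegative at all continuous positive definite functions. -/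
theorem IsPosDefFun.sum_integral_nonneg (h : IsPosDefFun φ) (hc : Continuous φ) {ι : Type*}
    (s : Finset ι) (c : ι → ℝ) (μ : ι → Measure E) [∀ i, IsProbabilityMeasure (μ i)]
    (hpos : ∀ x, 0 ≤ ∑ i ∈ s, c i * ∫ y, Real.cos ⟪y, x⟫ ∂μ i) :
    0 ≤ ∑ i ∈ s, c i * ∫ y, φ y ∂μ i := by
  have hmeas : ∀ ν : ℝ, StronglyMeasurable (gaussianSmoothing φ ν) := by
    intro ν
    refine StronglyMeasurable.integral_prod_right
      (f := fun y b : E => φ (y + ν⁻¹ • b) * Real.exp (-‖ν⁻¹ • (y + ν⁻¹ • b)‖ ^ 2 / 2)) ?_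
    exact (Continuous.measurable (by fun_prop)).stronglyMeasurable
  have hlim : Tendsto (fun n : ℕ => ∑ i ∈ s, c i * ∫ y, gaussianSmoothing φ (n : ℝ) y ∂μ i) atTop
      (𝓝 (∑ i ∈ s, c i * ∫ y, φ y ∂μ i)) := by
    refine tendsto_finsetSum _ fun i _ => Tendsto.const_mul _ ?_
    refine tendsto_integral_of_dominated_convergence (fun _ => φ 0)
      (fun n => (hmeas n).aestronglyMeasurable) (integrable_const _)
      (fun n => Eventually.of_forall fun b => h.abs_gaussianSmoothing_le _ _)
      (Eventually.of_forall fun y => h.tendsto_gaussianSmoothing hc y)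
  refine ge_of_tendsto hlim ?_
  filter_upwards [eventually_gt_atTop 0] with n hn
  have hν : (0 : ℝ) < n := Nat.cast_pos.2 hn
  have hm : StronglyMeasurable fun x : E =>
      ∫ a, φ ((n : ℝ) • a) * Real.cos ⟪(n : ℝ) • a, (n : ℝ) • x⟫ ∂stdGaussian E := by
    refine StronglyMeasurable.integral_prod_right
      (f := fun x a : E => φ ((n : ℝ) • a) * Real.cos ⟪(n : ℝ) • a, (n : ℝ) • x⟫) ?_
    exact (Continuous.measurable (by fun_prop)).stronglyMeasurable
  have hint : ∀ i, Integrable (fun x : E => (∫ y, Real.cos ⟪y, (n : ℝ) • x⟫ ∂μ i) *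
        ∫ a, φ ((n : ℝ) • a) * Real.cos ⟪(n : ℝ) • a, (n : ℝ) • x⟫ ∂stdGaussian E)
        (stdGaussian E) := by
    intro i
    refine Integrable.of_bound (C := φ 0) ?_ (Eventually.of_forall fun x => ?_)
    · refine AEStronglyMeasurable.mul ?_ hm.aestronglyMeasurable
      refine (StronglyMeasurable.integral_prod_right
        (f := fun x y : E => Real.cos ⟪y, (n : ℝ) • x⟫) ?_).aestronglyMeasurable
      exact (Continuous.measurable (by fun_prop)).stronglyMeasurable
    · rw [mul_comm]
      refine abs_mul_le_of_abs_le ?_ ?_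
      · have := norm_integral_le_of_norm_le_const (μ := stdGaussian E)
          (f := fun a => φ ((n : ℝ) • a) * Real.cos ⟪(n : ℝ) • a, (n : ℝ) • x⟫) (C := φ 0)
          (Eventually.of_forall fun b =>
            abs_mul_le_of_abs_le (h.abs_le _) (Real.abs_cos_le_one _))
        simpa using this
      · have := norm_integral_le_of_norm_le_const (μ := μ i)
          (f := fun y => Real.cos ⟪y, (n : ℝ) • x⟫) (C := 1)
          (Eventually.of_forall fun b => Real.abs_cos_le_one _)
        simpa using this
  have e : ∀ i, c i * ∫ y, gaussianSmoothing φ (n : ℝ) y ∂μ i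
      = ((n : ℝ) ^ 2) ^ Module.finrank ℝ E *
        ∫ x, c i * ((∫ y, Real.cos ⟪y, (n : ℝ) • x⟫ ∂μ i) *
          ∫ a, φ ((n : ℝ) • a) * Real.cos ⟪(n : ℝ) • a, (n : ℝ) • x⟫ ∂stdGaussian E)
          ∂stdGaussian E := by
    intro i
    rw [h.integral_gaussianSmoothing hc hν, integral_const_mul]
    ring
  simp_rw [e]
  rw [← Finset.mul_sum, ← integral_finsetSum _ fun i _ => (hint i).const_mul _]
  refine mul_nonneg (by positivity) (integral_nonneg fun x => ?_)
  simp only [← mul_assoc]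
  rw [← Finset.sum_mul]
  exact mul_nonneg (hpos _) (h.integral_mul_cos_nonneg hc _ _)

end Smoothing

/-! ### Homogeneous negative definite functions and the energy inequality -/

section NegativeDefinite

open MeasureTheory ProbabilityTheory Filter Topology
open scoped RealInnerProductSpace

/-- A continuous function on a real vector space which is homogeneous of degree `r` and negative
definite. -/
structure IsHomNegDefFun {E : Type*} [NormedAddCommGroup E] [NormedSpace ℝ E] (ψ : E → ℝ)
    (r : ℝ) : Prop where
  continuous : Continuous ψ
  map_smul : ∀ (t : ℝ) (x : E), ψ (t • x) = |t| ^ r * ψ x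
  sum_nonpos : ∀ (ι : Type) [Fintype ι] (s : ι → E) (ξ : ι → ℝ), ∑ i, ξ i = 0 →
    ∑ i, ∑ j, ξ i * ξ j * ψ (s i - s j) ≤ 0

namespace IsHomNegDefFun

section Basic

variable {E : Type*} [NormedAddCommGroup E] [NormedSpace ℝ E] {ψ : E → ℝ} {r : ℝ}

theorem map_neg (h : IsHomNegDefFun ψ r) (x : E) : ψ (-x) = ψ x := by
  simpa using h.map_smul (-1) x

theorem map_zero (h : IsHomNegDefFun ψ r) (hr : 0 < r) : ψ 0 = 0 := by
  simpa [Real.zero_rpow hr.ne'] using h.map_smul 0 0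

/-- Put weights `1, -1, -1, 1` on the vertices `0, x, y, x + y` of a parallelogram. -/
theorem parallelogram_le (h : IsHomNegDefFun ψ r) (hr : 0 < r) (x y : E) :
    ψ (x + y) + ψ (x - y) ≤ 2 * ψ x + 2 * ψ y := by
  have h1 := h.sum_nonpos (Fin 4) ![0, x, y, x + y] ![1, -1, -1, 1] (by
    simp [Fin.sum_univ_four])
  have e1 : ψ (-y + -x) = ψ (x + y) := by rw [← h.map_neg]; congr 1; abel
  have e2 : ψ (y - x) = ψ (x - y) := by rw [← h.map_neg]; congr 1; abel
  simp [Fin.sum_univ_four, h.map_neg, h.map_zero hr, e1, e2] at h1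
  linarith

/-- Apply negative definiteness to the points `s i ± b / 2` with weights `± ξ i`. These have sum
zero for arbitrary `ξ`, so no condition on `ξ` remains. -/
theorem isPosDefFun (h : IsHomNegDefFun ψ r) (b : E) :
    IsPosDefFun fun a => (ψ (a + b) + ψ (a - b)) / 2 - ψ a where
  even x := by
    rw [h.map_neg x, show -x + b = -(x - b) by abel, show -x - b = -(x + b) by abel, h.map_neg,
      h.map_neg]
    ring
  sum_nonneg n s ξ := by
    have h1 := h.sum_nonpos (Fin n ⊕ Fin n)
      (Sum.elim (fun i => s i + (1 / 2 : ℝ) • b) fun i => s i - (1 / 2 : ℝ) • b)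
      (Sum.elim ξ fun i => -ξ i) (by simp)
    have hb : (1 / 2 : ℝ) • b + (1 / 2 : ℝ) • b = b := by rw [← add_smul]; norm_num
    have e1 : ∀ i j, s i + (1 / 2 : ℝ) • b - (s j - (1 / 2 : ℝ) • b) = s i - s j + b := by
      intro i j
      calc _ = s i - s j + ((1 / 2 : ℝ) • b + (1 / 2 : ℝ) • b) := by abel
        _ = _ := by rw [hb]
    have e2 : ∀ i j, s i - (1 / 2 : ℝ) • b - (s j + (1 / 2 : ℝ) • b) = s i - s j - b := by
      intro i j
      calc _ = s i - s j - ((1 / 2 : ℝ) • b + (1 / 2 : ℝ) • b) := by abel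
        _ = _ := by rw [hb]
    simp only [Fintype.sum_sum_type, Sum.elim_inl, Sum.elim_inr, add_sub_add_right_eq_sub,
      sub_sub_sub_cancel_right, e1, e2, ← Finset.sum_add_distrib] at h1
    have h2 : ∑ i, ∑ j, ξ i * ξ j * ((ψ (s i - s j + b) + ψ (s i - s j - b)) / 2 - ψ (s i - s j))
        = -(1 / 2) * ∑ i, ∑ j, (ξ i * ξ j * ψ (s i - s j) + ξ i * -ξ j * ψ (s i - s j + b)
          + (-ξ i * ξ j * ψ (s i - s j - b) + -ξ i * -ξ j * ψ (s i - s j))) := by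
      rw [Finset.mul_sum]
      refine Finset.sum_congr rfl fun i _ => ?_
      rw [Finset.mul_sum]
      exact Finset.sum_congr rfl fun j _ => by ring
    rw [h2]
    linarith

variable [FiniteDimensional ℝ E]

/-- By homogeneity, a bound on the unit ball extends with growth `‖x‖ ^ r`. For `r ≤ 2`, finite
second moments therefore suffice for all integrability below. -/
theorem exists_abs_le (h : IsHomNegDefFun ψ r) (hr : r ≤ 2) :
    ∃ C, ∀ x, |ψ x| ≤ C * (1 + ‖x‖ ^ 2) := by
  obtain ⟨C, hC⟩ := (ProperSpace.isCompact_closedBall (0 : E) 1).exists_bound_of_continuousOn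
    h.continuous.continuousOn
  have hC0 : 0 ≤ C := (norm_nonneg _).trans (hC 0 (by simp))
  refine ⟨C, fun x => ?_⟩
  rcases le_total ‖x‖ 1 with hx | hx
  · have := hC x (by simpa using hx)
    rw [Real.norm_eq_abs] at this
    nlinarith [mul_nonneg hC0 (sq_nonneg ‖x‖)]
  · have hx0 : ‖x‖ ≠ 0 := by linarith
    have e : x = ‖x‖ • (‖x‖⁻¹ • x) := by rw [smul_smul, mul_inv_cancel₀ hx0, one_smul]
    have h1 := hC (‖x‖⁻¹ • x) (by simp [norm_smul, inv_mul_cancel₀ hx0])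
    rw [Real.norm_eq_abs] at h1
    rw [e, h.map_smul, abs_mul, ← e, abs_norm, abs_of_nonneg (Real.rpow_nonneg (norm_nonneg _) _)]
    have h2 : ‖x‖ ^ r ≤ ‖x‖ ^ 2 := by
      rw [← Real.rpow_two]
      exact Real.rpow_le_rpow_of_exponent_le hx hr
    nlinarith [mul_le_mul h2 h1 (abs_nonneg _) (sq_nonneg ‖x‖)]

theorem integrable_comp [MeasurableSpace E] [BorelSpace E] (h : IsHomNegDefFun ψ r) (hr : r ≤ 2)
    {Ω : Type*} [MeasurableSpace Ω] {μ : Measure Ω} [IsFiniteMeasure μ] {f : Ω → E}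
    (hf : MemLp f 2 μ) : Integrable (fun ω => ψ (f ω)) μ := by
  obtain ⟨C, hC⟩ := h.exists_abs_le hr
  have h1 : Integrable (fun ω => C * (1 + ‖f ω‖ ^ 2)) μ :=
    ((integrable_const _).add hf.norm.integrable_sq).const_mul C
  exact h1.mono' (h.continuous.comp_aestronglyMeasurable hf.1) (Eventually.of_forall fun ω => hC _)

end Basic

variable {E : Type*} [NormedAddCommGroup E] [InnerProductSpace ℝ E] [FiniteDimensional ℝ E]
  [MeasurableSpace E] [BorelSpace E] {ψ : E → ℝ} {r : ℝ}

/-- The energy inequality for negative definite functions. -/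
theorem integral_sub_add_integral_sub_le (h : IsHomNegDefFun ψ r) (hr0 : 0 < r) (hr : r ≤ 2)
    (μ ν : Measure E) [IsProbabilityMeasure μ] [IsProbabilityMeasure ν] (hμ : MemLp id 2 μ)
    (hν : MemLp id 2 ν) :
    ∫ z, ψ (z.1 - z.2) ∂μ.prod μ + ∫ z, ψ (z.1 - z.2) ∂ν.prod ν
      ≤ 2 * ∫ z, ψ (z.1 - z.2) ∂μ.prod ν := by
  have hψ := h.continuous
  have hint : ∀ (μ ν : Measure E) [IsProbabilityMeasure μ] [IsProbabilityMeasure ν],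
      MemLp id 2 μ → MemLp id 2 ν → Integrable (fun z : E × E => ψ (z.1 - z.2)) (μ.prod ν) :=
    fun μ ν _ _ hμ hν => h.integrable_comp hr ((hμ.comp_fst ν).sub (hν.comp_snd μ))
  have p1 : MeasurePreserving (Prod.fst : E × E → E) (μ.prod ν) μ := measurePreserving_fst
  have p2 : MeasurePreserving (Prod.snd : E × E → E) (μ.prod ν) ν := measurePreserving_snd
  have m11 := p1.prod p1
  have m12 := p1.prod p2
  have m21 := p2.prod p1
  have m22 := p2.prod p2
  have i11 := m11.integrable_comp_of_integrable (hint μ μ hμ hμ)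
  have i12 := m12.integrable_comp_of_integrable (hint μ ν hμ hν)
  have i21 := m21.integrable_comp_of_integrable (hint ν μ hν hμ)
  have i22 := m22.integrable_comp_of_integrable (hint ν ν hν hν)
  have heq : ∀ {α β : Measure E} [IsProbabilityMeasure α] [IsProbabilityMeasure β]
      {g : (E × E) × (E × E) → E × E}, MeasurePreserving g ((μ.prod ν).prod (μ.prod ν))
        (α.prod β) → ∫ z, ψ ((g z).1 - (g z).2) ∂(μ.prod ν).prod (μ.prod ν)
          = ∫ z, ψ (z.1 - z.2) ∂α.prod β := by
    intro α β _ _ g hg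
    rw [← hg.map_eq, integral_map hg.measurable.aemeasurable
      (Continuous.measurable (by fun_prop)).aestronglyMeasurable]
  have hswap : ∫ z, ψ (z.1 - z.2) ∂ν.prod μ = ∫ z, ψ (z.1 - z.2) ∂μ.prod ν := by
    rw [← integral_prod_swap]
    refine integral_congr_ae (Eventually.of_forall fun z => ?_)
    simp only [Prod.fst_swap, Prod.snd_swap]
    rw [← h.map_neg, neg_sub]
  -- On independent pairs `(x, y)`, `(x', y')` the kernel is `ψ(x - y') + ψ(y - x') - ψ(x - x') -
  -- ψ(y - y')`. Its finite sums are minus the form of `ψ` at the points `x_i` with weight `1` and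
  -- `y_i` with weight `-1`.
  have key := integral_prod_nonneg_of_sum_nonneg (μ.prod ν) (((i12.add i21).sub i11).sub i22)
    (by
      have := hint μ ν hμ hν
      have h' : Integrable (fun z : E × E => ψ (z.2 - z.1)) (μ.prod ν) := by
        refine this.congr (Eventually.of_forall fun z => ?_)
        simp only
        rw [← h.map_neg, neg_sub]
      refine (this.add h').congr (Eventually.of_forall fun z => ?_)
      simp [h.map_zero hr0])
    (by
      intro n ω
      have h1 := h.sum_nonpos (Fin n ⊕ Fin n)
        (Sum.elim (fun i => (ω i).1) fun i => (ω i).2) (Sum.elim (fun _ => 1) fun _ => -1)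
        (by simp)
      simp only [Fintype.sum_sum_type, Sum.elim_inl, Sum.elim_inr,
        ← Finset.sum_add_distrib] at h1
      rw [← neg_nonneg, ← Finset.sum_neg_distrib] at h1
      refine h1.trans_eq (Finset.sum_congr rfl fun i _ => ?_)
      rw [← Finset.sum_neg_distrib]
      refine Finset.sum_congr rfl fun j _ => ?_
      simp
      ring)
  have e : ∫ z, ψ (z.1 - z.2) ∂μ.prod ν + ∫ z, ψ (z.1 - z.2) ∂ν.prod μ
      - ∫ z, ψ (z.1 - z.2) ∂μ.prod μ - ∫ z, ψ (z.1 - z.2) ∂ν.prod ν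
      = ∫ z, ((((fun z : E × E => ψ (z.1 - z.2)) ∘ Prod.map Prod.fst Prod.snd +
        (fun z : E × E => ψ (z.1 - z.2)) ∘ Prod.map Prod.snd Prod.fst) -
        (fun z : E × E => ψ (z.1 - z.2)) ∘ Prod.map Prod.fst Prod.fst) -
        (fun z : E × E => ψ (z.1 - z.2)) ∘ Prod.map Prod.snd Prod.snd : (E × E) × (E × E) → ℝ) z
        ∂(μ.prod ν).prod (μ.prod ν) := by
    rw [integral_sub' ((i12.add i21).sub i11) i22, integral_sub' (i12.add i21) i11,
      integral_add' i12 i21, ← heq m11, ← heq m12, ← heq m21, ← heq m22]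
    rfl
  rw [← e, hswap] at key
  linarith

end IsHomNegDefFun

end NegativeDefinite

/-! ### Comparison of isotropic families through the Gaussian average -/

section GaussianAverages

open MeasureTheory ProbabilityTheory Filter Topology
open scoped RealInnerProductSpace

variable {E : Type*} [NormedAddCommGroup E] [InnerProductSpace ℝ E] [FiniteDimensional ℝ E]
  [MeasurableSpace E] [BorelSpace E] {ψ : E → ℝ} {r : ℝ}

/-- The law of `Z • w` for a standard real Gaussian variable `Z`. -/
noncomputable def gaussianLine (w : E) : Measure E := (gaussianReal 0 1).map fun z => z • w

instance (w : E) : IsProbabilityMeasure (gaussianLine w) :=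
  Measure.isProbabilityMeasure_map (by fun_prop)

omit [FiniteDimensional ℝ E] in
theorem integral_gaussianLine {f : E → ℝ} (hf : Continuous f) (w : E) :
    ∫ y, f y ∂gaussianLine w = ∫ z : ℝ, f (z • w) ∂gaussianReal 0 1 := by
  rw [gaussianLine, integral_map (by fun_prop) hf.measurable.aestronglyMeasurable]

theorem memLp_gaussianLine (w : E) : MemLp id 2 (gaussianLine w) := by
  rw [gaussianLine, memLp_map_measure_iff aestronglyMeasurable_id (by fun_prop)]
  have h : MemLp (id : ℝ → ℝ) 2 (gaussianReal 0 1) := IsGaussian.memLp_two_id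
  refine (h.norm.mul_const ‖w‖).mono (by fun_prop) (Eventually.of_forall fun z => ?_)
  simp [norm_smul]

theorem charFun_gaussianLine (w x : E) :
    charFun (gaussianLine w) x = (Real.exp (-⟪w, x⟫ ^ 2 / 2) : ℝ) := by
  have h := charFun_gaussianReal (μ := 0) (v := 1) ⟪w, x⟫
  rw [charFun_apply_real] at h
  rw [charFun_apply, gaussianLine, integral_map (by fun_prop) (by fun_prop)]
  simp only [inner_smul_left, Complex.ofReal_mul, RCLike.conj_to_real]
  simp only [mul_comm (Complex.ofReal _) (Complex.ofReal ⟪w, x⟫)]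
  rw [h]
  push_cast
  congr 1
  simp [neg_div]

theorem integral_cos_gaussianLine (w x : E) :
    ∫ y, Real.cos ⟪y, x⟫ ∂gaussianLine w = Real.exp (-⟪w, x⟫ ^ 2 / 2) := by
  rw [integral_cos_inner, charFun_gaussianLine, Complex.ofReal_re]

theorem gaussianLine_map_neg (w : E) : (gaussianLine w).map (fun x => -x) = gaussianLine w := by
  have : IsProbabilityMeasure ((gaussianLine w).map fun x => -x) :=
    Measure.isProbabilityMeasure_map (by fun_prop)
  refine Measure.ext_of_charFun (funext fun t => ?_)
  have e : (fun x : E => -x) = fun x => (-1 : ℝ) • x := by simp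
  rw [e, charFun_map_smul, charFun_gaussianLine, charFun_gaussianLine]
  simp

theorem memLp_stdGaussian : MemLp id 2 (stdGaussian E) := IsGaussian.memLp_two_id

/-- The absolute moment of order `r` of the standard real Gaussian. -/
noncomputable def gaussianMoment (r : ℝ) : ℝ := ∫ z : ℝ, |z| ^ r ∂gaussianReal 0 1

theorem gaussianMoment_pos (hr0 : 0 < r) (hr : r ≤ 2) : 0 < gaussianMoment r := by
  have hint : Integrable (fun z : ℝ => |z| ^ r) (gaussianReal 0 1) := by
    have h : MemLp (id : ℝ → ℝ) 2 (gaussianReal 0 1) := IsGaussian.memLp_two_id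
    have h1 : Integrable (fun z : ℝ => 1 + z ^ 2) (gaussianReal 0 1) :=
      (integrable_const _).add h.integrable_sq
    have hr' := hr0.le
    refine h1.mono' (Measurable.aestronglyMeasurable (by fun_prop)) (Eventually.of_forall fun z => ?_)
    rw [Real.norm_of_nonneg (Real.rpow_nonneg (abs_nonneg z) r)]
    rcases le_total |z| 1 with hz | hz
    · have := Real.rpow_le_one (abs_nonneg z) hz hr0.le
      nlinarith [sq_nonneg z]
    · have := Real.rpow_le_rpow_of_exponent_le hz hr
      rw [Real.rpow_two, sq_abs] at this
      linarith
  rw [gaussianMoment, integral_pos_iff_support_of_nonneg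
    (fun z => Real.rpow_nonneg (abs_nonneg z) r) hint]
  have hsupp : Function.support (fun z : ℝ => |z| ^ r) = {0}ᶜ := by
    ext z
    simp only [Function.mem_support, Set.mem_compl_iff, Set.mem_singleton_iff]
    rw [not_iff_not, Real.rpow_eq_zero (abs_nonneg z) hr0.ne', abs_eq_zero]
  have : NullSingletonClass (gaussianReal 0 1) := nullSingletonClass_gaussianReal one_ne_zero
  rw [hsupp, prob_compl_eq_one_sub (measurableSet_singleton 0), measure_singleton]
  simp

namespace IsHomNegDefFun

omit [FiniteDimensional ℝ E] in
theorem integral_gaussianLine_eq (h : IsHomNegDefFun ψ r) (w : E) :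
    ∫ y, ψ y ∂gaussianLine w = gaussianMoment r * ψ w := by
  rw [integral_gaussianLine h.continuous, gaussianMoment, ← integral_mul_const]
  simp_rw [h.map_smul]

omit [FiniteDimensional ℝ E] in
theorem integral_map_sqrt_two (h : IsHomNegDefFun ψ r) (μ : Measure E) :
    ∫ y, ψ y ∂μ.map (fun x => √2 • x) = 2 ^ (r / 2) * ∫ y, ψ y ∂μ := by
  rw [integral_map (by fun_prop) h.continuous.measurable.aestronglyMeasurable,
    ← integral_const_mul]
  refine integral_congr_ae (Eventually.of_forall fun y => ?_)
  simp only
  rw [h.map_smul, abs_of_nonneg (Real.sqrt_nonneg 2), Real.sqrt_eq_rpow, ← Real.rpow_mul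
    (by norm_num)]
  congr 2
  ring

/-- Dyadic averaging of covariances: if `X` and `Y` are independent with the laws found for the two
halves, take the law of `(X - Y) / √2`. The energy inequality shows that its mean of `ψ` is at least
the average of the two means. -/
theorem exists_measure_of_average (h : IsHomNegDefFun ψ r) (hr0 : 0 < r) (hr : r ≤ 2) (j : ℕ) :
    ∀ w : (Fin j → Bool) → E, ∃ μ : Measure E, IsProbabilityMeasure μ ∧ MemLp id 2 μ ∧
      (∀ x, charFun μ x = (Real.exp (-(∑ l, ⟪w l, x⟫ ^ 2) / 2 ^ j / 2) : ℝ)) ∧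
      (∑ l, ∫ y, ψ y ∂gaussianLine (w l)) / 2 ^ j ≤ ∫ y, ψ y ∂μ := by
  induction j with
  | zero =>
    intro w
    refine ⟨gaussianLine (w fun _ => false), inferInstance, memLp_gaussianLine _, fun x => ?_, ?_⟩
    · rw [Fintype.sum_subsingleton _ fun _ => false]
      simp [charFun_gaussianLine]
    · rw [Fintype.sum_subsingleton _ fun _ => false]
      simp
  | succ j ih =>
    intro w
    have hsplit : ∀ f : (Fin (j + 1) → Bool) → ℝ,
        ∑ l, f l = ∑ l : Fin j → Bool, f (Fin.cons true l)
          + ∑ l : Fin j → Bool, f (Fin.cons false l) := by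
      intro f
      rw [← (Fin.consEquiv fun _ : Fin (j + 1) => Bool).sum_comp, Fintype.sum_prod_type,
        Fintype.sum_bool]
      rfl
    obtain ⟨μ, hμp, hμ2, hμc, hμ⟩ := ih fun l => w (Fin.cons true l)
    obtain ⟨ν, hνp, hν2, hνc, hν⟩ := ih fun l => w (Fin.cons false l)
    have hp : IsProbabilityMeasure ((μ.prod ν).map fun z => z.1 - z.2) :=
      Measure.isProbabilityMeasure_map (by fun_prop)
    -- A law whose characteristic function is the exponential of a quadratic form is stable: the
    -- difference of two independent copies is distributed as `√2` times one. Hence its self-energy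
    -- is `2 ^ (r/2)` times its mean of `ψ`, the same factor as in `∫ ψ (x - y)` for the mixed pair.
    have hself : ∀ (ρ : Measure E) [IsProbabilityMeasure ρ] (a : E → ℝ)
        (ha : ∀ (t : ℝ) (x : E), a (t • x) = t ^ 2 * a x),
        (∀ x, charFun ρ x = (Real.exp (-(a x) / 2 ^ j / 2) : ℝ)) →
        ∫ z, ψ (z.1 - z.2) ∂ρ.prod ρ = 2 ^ (r / 2) * ∫ y, ψ y ∂ρ := by
      intro ρ _ a ha hc
      have h1 : IsProbabilityMeasure (ρ.map fun x => √2 • x) :=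
        Measure.isProbabilityMeasure_map (by fun_prop)
      have h2 : IsProbabilityMeasure ((ρ.prod ρ).map fun z => z.1 - z.2) :=
        Measure.isProbabilityMeasure_map (by fun_prop)
      have hmap : (ρ.prod ρ).map (fun z => z.1 - z.2) = ρ.map fun x => √2 • x := by
        refine Measure.ext_of_charFun (funext fun t => ?_)
        have hneg : a (-t) = a t := by simpa using ha (-1) t
        rw [charFun_map_sub, charFun_map_smul, hc, hc, hc, ha, hneg, Real.sq_sqrt (by norm_num),
          ← Complex.ofReal_mul, ← Real.exp_add]
        congr 2
        ring
      rw [← h.integral_map_sqrt_two, ← hmap, integral_map (by fun_prop)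
        h.continuous.measurable.aestronglyMeasurable]
    have hsq : ∀ w' : (Fin j → Bool) → E, ∀ (t : ℝ) (x : E),
        ∑ l, ⟪w' l, t • x⟫ ^ 2 = t ^ 2 * ∑ l, ⟪w' l, x⟫ ^ 2 := by
      intro w' t x
      simp_rw [inner_smul_right, mul_pow, Finset.mul_sum]
    have hen := h.integral_sub_add_integral_sub_le hr0 hr μ ν hμ2 hν2
    rw [hself μ _ (hsq _) hμc, hself ν _ (hsq _) hνc] at hen
    have hs2 : (√2)⁻¹ ^ 2 = (1 / 2 : ℝ) := by rw [inv_pow, Real.sq_sqrt (by norm_num)]; norm_num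
    have hm2 : MemLp id 2 ((μ.prod ν).map fun z => z.1 - z.2) := by
      rw [memLp_map_measure_iff aestronglyMeasurable_id (by fun_prop)]
      exact (hμ2.comp_fst ν).sub (hν2.comp_snd μ)
    refine ⟨((μ.prod ν).map fun z => z.1 - z.2).map fun x => (√2)⁻¹ • x,
      Measure.isProbabilityMeasure_map (by fun_prop), ?_, fun x => ?_, ?_⟩
    · rw [memLp_map_measure_iff aestronglyMeasurable_id (by fun_prop)]
      exact hm2.const_smul (√2)⁻¹
    · rw [charFun_map_smul, charFun_map_sub, hμc, hνc, ← smul_neg, hsq, hsq, hs2,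
        ← Complex.ofReal_mul, ← Real.exp_add, hsplit]
      simp only [inner_neg_right, neg_sq]
      congr 2
      rw [pow_succ]
      field_simp
      ring
    · have e1 : ∫ y, ψ y ∂((μ.prod ν).map fun z => z.1 - z.2)
          = ∫ z, ψ (z.1 - z.2) ∂μ.prod ν :=
        integral_map (by fun_prop) h.continuous.measurable.aestronglyMeasurable
      have e2 := h.integral_map_sqrt_two
        (((μ.prod ν).map fun z => z.1 - z.2).map fun x => (√2)⁻¹ • x)
      rw [Measure.map_map (by fun_prop) (by fun_prop)] at e2
      have e3 : ((fun x : E => √2 • x) ∘ fun x : E => (√2)⁻¹ • x) = id := by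
        funext x
        simp [smul_smul]
      rw [e3, Measure.map_id, e1] at e2
      rw [e2, ← mul_add, mul_left_comm] at hen
      have hpos : (0 : ℝ) < 2 ^ (r / 2) := Real.rpow_pos_of_pos (by norm_num) _
      have h3 := le_of_mul_le_mul_left hen hpos
      rw [hsplit, pow_succ, ← div_div, add_div]
      linarith

/-- Averages over random vectors with standard covariance, multiplied by independent Gaussian
scalars, are at most the Gaussian average. -/
theorem sum_gaussianLine_le (h : IsHomNegDefFun ψ r) (hr0 : 0 < r) (hr : r ≤ 2) {j : ℕ}
    (w : (Fin j → Bool) → E) (hw : ∀ x, ∑ l, ⟪w l, x⟫ ^ 2 = 2 ^ j * ‖x‖ ^ 2) :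
    (∑ l, ∫ y, ψ y ∂gaussianLine (w l)) / 2 ^ j ≤ ∫ y, ψ y ∂stdGaussian E := by
  obtain ⟨μ, hμp, -, hμc, hμ⟩ := h.exists_measure_of_average hr0 hr j w
  have : μ = stdGaussian E := by
    refine Measure.ext_of_charFun (funext fun t => ?_)
    rw [hμc, hw, charFun_stdGaussian, neg_div, mul_div_cancel_left₀ _ (by positivity)]
    push_cast
    rfl
  rwa [this] at hμ

omit [FiniteDimensional ℝ E] in
theorem integral_sub_eq_integral_add (h : IsHomNegDefFun ψ r) {μ : Measure E}
    (hμ : μ.map (fun x => -x) = μ) (b : E) : ∫ y, ψ (y - b) ∂μ = ∫ y, ψ (y + b) ∂μ := by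
  have hψ := h.continuous
  conv_lhs => rw [← hμ]
  rw [integral_map (by fun_prop) (Continuous.measurable (by fun_prop)).aestronglyMeasurable]
  refine integral_congr_ae (Eventually.of_forall fun y => ?_)
  simp only
  rw [← h.map_neg]
  congr 1
  abel

theorem integral_difference (h : IsHomNegDefFun ψ r) (hr : r ≤ 2) {μ : Measure E}
    [IsProbabilityMeasure μ] (h2 : MemLp id 2 μ) (hμ : μ.map (fun x => -x) = μ) (b : E) :
    ∫ y, ((ψ (y + b) + ψ (y - b)) / 2 - ψ y) ∂μ = ∫ y, ψ (y + b) ∂μ - ∫ y, ψ y ∂μ := by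
  have i1 : Integrable (fun y => ψ (y + b)) μ := h.integrable_comp hr (h2.add (memLp_const b))
  have i2 : Integrable (fun y => ψ (y - b)) μ := h.integrable_comp hr (h2.sub (memLp_const b))
  have i3 : Integrable (fun y => ψ y) μ := h.integrable_comp hr h2
  have i4 : Integrable (fun y => (ψ (y + b) + ψ (y - b)) / 2) μ := (i1.add i2).div_const 2
  rw [integral_sub i4 i3, integral_div, integral_add i1 i2,
    h.integral_sub_eq_integral_add hμ]
  ring

/-- The Gaussian has a positive Fourier transform, so the second difference of `ψ` with step `b` has
a nonnegative Gaussian mean; by symmetry the shifts by `b` and `-b` contribute equally. -/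
theorem integral_stdGaussian_le_add (h : IsHomNegDefFun ψ r) (hr : r ≤ 2) (b : E) :
    ∫ y, ψ y ∂stdGaussian E ≤ ∫ y, ψ (y + b) ∂stdGaussian E := by
  have hψ := h.continuous
  have h1 := (h.isPosDefFun b).sum_integral_nonneg (by fun_prop) {()} (fun _ => 1)
    (fun _ => stdGaussian E) (by
      intro x
      simp only [Finset.sum_singleton, one_mul, integral_cos_stdGaussian]
      positivity)
  simp only [Finset.sum_singleton, one_mul] at h1
  rw [h.integral_difference hr memLp_stdGaussian stdGaussian_map_neg] at h1
  linarith

end IsHomNegDefFun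

theorem one_sub_exp_neg_ge {v : ℝ} (hv : 0 ≤ v) : v - v ^ 2 / 2 ≤ 1 - Real.exp (-v) := by
  have h1 : Real.exp (-v) ≤ 1 / (1 + v + v ^ 2 / 2) := by
    rw [Real.exp_neg, ← one_div]
    exact one_div_le_one_div_of_le (by positivity) (Real.quadratic_le_exp_of_nonneg hv)
  have h2 : 1 / (1 + v + v ^ 2 / 2) ≤ 1 - v + v ^ 2 / 2 := by
    rw [div_le_iff₀ (by positivity)]
    nlinarith [pow_nonneg hv 2, pow_nonneg hv 3, pow_nonneg hv 4]
  linarith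

/-- A second moment bound: if `v ≥ 0` has mean `m` and second moment at most `9 m²`, then
`E (1 - exp (-v)) ≥ (1 - exp (-m)) / 18`. -/
theorem sum_one_sub_exp_neg_ge {κ : Type*} [Fintype κ] [Nonempty κ] (v : κ → ℝ) (hv : ∀ l, 0 ≤ v l)
    {m : ℝ} (h1 : ∑ l, v l = Fintype.card κ * m) (h2 : ∑ l, v l ^ 2 ≤ Fintype.card κ * (9 * m ^ 2)) :
    Fintype.card κ * ((1 / 18) * (1 - Real.exp (-m))) ≤ ∑ l, (1 - Real.exp (-v l)) := by
  have hcard : (0 : ℝ) < Fintype.card κ := by exact_mod_cast Fintype.card_pos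
  have hm : 0 ≤ m := by
    have : 0 ≤ ∑ l, v l := Finset.sum_nonneg fun l _ => hv l
    rw [h1] at this
    exact nonneg_of_mul_nonneg_right this hcard
  -- Shrinking `v` to `t v` only lowers `1 - exp (-v)`, and keeps the quadratic lower bound useful
  -- for large `m`. The choice is `t = 1` for `m ≤ 1/9`, and otherwise `t = 1/(9m)`, where the bound
  -- becomes `1/9 - 1/18 = 1/18`.
  have key : ∀ t : ℝ, 0 ≤ t → t ≤ 1 → Fintype.card κ * (t * m - 9 * (t * m) ^ 2 / 2)
      ≤ ∑ l, (1 - Real.exp (-v l)) := by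
    intro t ht0 ht1
    have h3 : ∀ l, t * v l - (t * v l) ^ 2 / 2 ≤ 1 - Real.exp (-v l) := by
      intro l
      have h4 : Real.exp (-v l) ≤ Real.exp (-(t * v l)) :=
        Real.exp_le_exp.2 (neg_le_neg (by nlinarith [hv l]))
      linarith [one_sub_exp_neg_ge (mul_nonneg ht0 (hv l))]
    calc _ ≤ ∑ l, (t * v l - (t * v l) ^ 2 / 2) := by
          simp_rw [mul_pow, Finset.sum_sub_distrib, ← Finset.sum_div, ← Finset.mul_sum]
          rw [h1]
          nlinarith [mul_le_mul_of_nonneg_left h2 (sq_nonneg t)]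
      _ ≤ _ := Finset.sum_le_sum fun l _ => h3 l
  rcases le_total m (1 / 9) with hm9 | hm9
  · refine le_trans (mul_le_mul_of_nonneg_left ?_ hcard.le) (key 1 zero_le_one le_rfl)
    have := Real.add_one_le_exp (-m)
    nlinarith
  · have hmpos : 0 < m := by linarith
    refine le_trans (mul_le_mul_of_nonneg_left ?_ hcard.le)
      (key (1 / (9 * m)) (by positivity) ?_)
    · have e : 1 / (9 * m) * m = 1 / 9 := by field_simp
      rw [e]
      have := Real.exp_pos (-m)
      linarith
    · rw [div_le_one (by positivity)]
      linarith

/-- The fourth moment bound prevents `⟪w, x⟫` from being concentrated near zero, so `1 - exp (-⟪w,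
x⟫² / 2)` is on average at least `1/18` of its Gaussian counterpart. Positive definiteness transfers
this from Fourier transforms to `ψ`. -/
theorem IsHomNegDefFun.integral_stdGaussian_le (h : IsHomNegDefFun ψ r) (hr0 : 0 < r) (hr : r ≤ 2)
    {κ : Type*} [Fintype κ] [Nonempty κ] (w : κ → E)
    (hw2 : ∀ x, ∑ l, ⟪w l, x⟫ ^ 2 = Fintype.card κ * ‖x‖ ^ 2)
    (hw4 : ∀ x, ∑ l, ⟪w l, x⟫ ^ 4 ≤ Fintype.card κ * (9 * ‖x‖ ^ 4)) :
    (2 - 2 ^ (r / 2)) / 18 * ∫ y, ψ y ∂stdGaussian E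
      ≤ (∑ l, ∫ y, ψ y ∂gaussianLine (w l)) / Fintype.card κ := by
  have hψ := h.continuous
  have hcard : (0 : ℝ) < Fintype.card κ := by exact_mod_cast Fintype.card_pos
  set A := ∫ y, ψ y ∂stdGaussian E with hA
  have hB : ∀ b : E, 0 ≤ 17 / 18 * ψ b + 1 / 18 * (∫ y, ψ (y - b) ∂stdGaussian E - A)
      - (∑ l, (∫ y, ψ (y - b) ∂gaussianLine (w l) - ∫ y, ψ y ∂gaussianLine (w l)))
        / Fintype.card κ := by
    intro b
    -- The three kinds of index encode the signed measure `17/18 δ_0 + 1/18 γ` minus the average of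
    -- the line laws. Its Fourier transform is nonnegative by `sum_one_sub_exp_neg_ge` with `v = ⟪w,
    -- x⟫² / 2` and `m = ‖x‖² / 2`.
    let μ : Option (Option κ) → Measure E := fun o =>
      o.elim (Measure.dirac 0) fun o => o.elim (stdGaussian E) fun l => gaussianLine (w l)
    let c : Option (Option κ) → ℝ := fun o =>
      o.elim (17 / 18) fun o => o.elim (1 / 18) fun _ => -(1 / Fintype.card κ)
    have hμ : ∀ o, IsProbabilityMeasure (μ o) := by
      rintro (_ | _ | l)
      · exact inferInstanceAs (IsProbabilityMeasure (Measure.dirac 0))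
      · exact inferInstanceAs (IsProbabilityMeasure (stdGaussian E))
      · exact inferInstanceAs (IsProbabilityMeasure (gaussianLine (w l)))
    have h1 := (h.isPosDefFun b).sum_integral_nonneg (by fun_prop) Finset.univ c μ (by
      intro x
      simp only [Fintype.sum_option, μ, c, Option.elim, integral_cos_stdGaussian,
        integral_cos_gaussianLine, integral_dirac, inner_zero_left, Real.cos_zero]
      have h2 := sum_one_sub_exp_neg_ge (fun l => ⟪w l, x⟫ ^ 2 / 2) (fun l => by positivity)
        (m := ‖x‖ ^ 2 / 2) (by rw [← Finset.sum_div, hw2]; ring) (by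
          have e : ∀ l, (⟪w l, x⟫ ^ 2 / 2) ^ 2 = ⟪w l, x⟫ ^ 4 / 4 := fun l => by ring
          simp_rw [e]
          rw [← Finset.sum_div]
          have := hw4 x
          nlinarith)
      rw [Finset.sum_sub_distrib] at h2
      simp only [Finset.sum_const, Finset.card_univ, nsmul_eq_mul, mul_one, neg_div',
        ← Finset.mul_sum] at h2 ⊢
      have e : -1 / (Fintype.card κ : ℝ) * ∑ l, Real.exp (-⟪w l, x⟫ ^ 2 / 2)
          = -((∑ l, Real.exp (-⟪w l, x⟫ ^ 2 / 2)) / Fintype.card κ) := by ring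
      have h3 : (∑ l, Real.exp (-⟪w l, x⟫ ^ 2 / 2)) / Fintype.card κ
          ≤ 1 - 1 / 18 * (1 - Real.exp (-‖x‖ ^ 2 / 2)) := by
        rw [div_le_iff₀ hcard]
        linarith
      rw [e]
      linarith)
    simp only [Fintype.sum_option, μ, c, Option.elim, integral_dirac] at h1
    rw [h.integral_difference hr memLp_stdGaussian stdGaussian_map_neg] at h1
    simp_rw [fun l => h.integral_difference hr (memLp_gaussianLine (w l))
      (gaussianLine_map_neg (w l)) b] at h1
    simp only [zero_add, zero_sub, h.map_neg, h.map_zero hr0, ← Finset.mul_sum] at h1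
    rw [h.integral_sub_eq_integral_add stdGaussian_map_neg]
    simp_rw [fun l => h.integral_sub_eq_integral_add (gaussianLine_map_neg (w l)) b]
    refine h1.trans_eq ?_
    ring
  have hint : ∀ μ : Measure E, IsProbabilityMeasure μ → MemLp id 2 μ →
      Integrable (fun z : E × E => ψ (z.1 - z.2)) (μ.prod (stdGaussian E)) := fun μ _ hμ =>
    h.integrable_comp hr ((hμ.comp_fst _).sub (memLp_stdGaussian.comp_snd μ))
  have hI0 : Integrable ψ (stdGaussian E) := h.integrable_comp hr memLp_stdGaussian
  have hI1 := (hint (stdGaussian E) inferInstance memLp_stdGaussian).integral_prod_right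
  have hI2 : ∀ l, Integrable (fun b => ∫ y, ψ (y - b) ∂gaussianLine (w l)) (stdGaussian E) :=
    fun l => (hint (gaussianLine (w l)) inferInstance
    (memLp_gaussianLine (w l))).integral_prod_right
  have hG : ∫ b, ∫ y, ψ (y - b) ∂stdGaussian E ∂stdGaussian E = 2 ^ (r / 2) * A := by
    rw [hA, ← h.integral_map_sqrt_two, ← stdGaussian_map_sub, integral_map (by fun_prop)
      hψ.measurable.aestronglyMeasurable, integral_prod_symm _
      (hint (stdGaussian E) inferInstance memLp_stdGaussian)]
  -- For each fixed `y` on the line, the Gaussian mean of `ψ (y - b)` over `b` is at least `A`,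
  -- because a shift does not decrease the Gaussian mean.
  have hW : ∀ l, A ≤ ∫ b, ∫ y, ψ (y - b) ∂gaussianLine (w l) ∂stdGaussian E := by
    intro l
    rw [← integral_prod_symm _ (hint (gaussianLine (w l)) inferInstance (memLp_gaussianLine _)),
      integral_prod _ (hint (gaussianLine (w l)) inferInstance (memLp_gaussianLine _))]
    have e : A = ∫ _, A ∂gaussianLine (w l) := by simp
    rw [e]
    refine integral_mono (integrable_const _)
      (hint (gaussianLine (w l)) inferInstance (memLp_gaussianLine _)).integral_prod_left
      fun a => ?_
    simp only
    refine (h.integral_stdGaussian_le_add hr a).trans_eq ?_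
    rw [← h.integral_sub_eq_integral_add stdGaussian_map_neg]
    refine integral_congr_ae (Eventually.of_forall fun y => ?_)
    simp only
    rw [← h.map_neg, neg_sub]
  have htot : 0 ≤ ∫ b, (17 / 18 * ψ b + 1 / 18 * (∫ y, ψ (y - b) ∂stdGaussian E - A)
      - (∑ l, (∫ y, ψ (y - b) ∂gaussianLine (w l) - ∫ y, ψ y ∂gaussianLine (w l)))
        / Fintype.card κ) ∂stdGaussian E := integral_nonneg hB
  have i1 : Integrable (fun b => 17 / 18 * ψ b) (stdGaussian E) := hI0.const_mul _
  have i2 : Integrable (fun b => 1 / 18 * (∫ y, ψ (y - b) ∂stdGaussian E - A)) (stdGaussian E) :=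
    (hI1.sub (integrable_const _)).const_mul _
  have i12 : Integrable (fun b => 17 / 18 * ψ b
      + 1 / 18 * (∫ y, ψ (y - b) ∂stdGaussian E - A)) (stdGaussian E) := i1.add i2
  have hI3 : ∀ l, Integrable (fun b => ∫ y, ψ (y - b) ∂gaussianLine (w l)
      - ∫ y, ψ y ∂gaussianLine (w l)) (stdGaussian E) := fun l =>
    (hI2 l).sub (integrable_const _)
  have i3 : Integrable (fun b => (∑ l, (∫ y, ψ (y - b) ∂gaussianLine (w l)
      - ∫ y, ψ y ∂gaussianLine (w l))) / Fintype.card κ) (stdGaussian E) :=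
    (integrable_finsetSum _ fun l _ => hI3 l).div_const _
  rw [integral_sub i12 i3, integral_add i1 i2, integral_const_mul, integral_const_mul,
    integral_sub hI1 (integrable_const _), hG, integral_div,
    integral_finsetSum _ fun l _ => hI3 l] at htot
  simp_rw [fun l => integral_sub (hI2 l) (integrable_const (∫ y, ψ y ∂gaussianLine (w l)))] at htot
  simp only [integral_const, probReal_univ, one_smul, ← hA, Finset.sum_sub_distrib, sub_div] at htot
  -- Write `W` for the average of the line means. Integrating `hB` over Gaussian `b` now gives `W ≥
  -- A - 17/18 A - (2 ^ (r/2) - 1)/18 A`, which is the claimed multiple of `A`.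
  have hlow : A ≤ (∑ l, ∫ b, ∫ y, ψ (y - b) ∂gaussianLine (w l) ∂stdGaussian E)
      / Fintype.card κ := by
    rw [le_div_iff₀ hcard]
    calc A * Fintype.card κ = ∑ _l : κ, A := by simp [mul_comm]
      _ ≤ _ := Finset.sum_le_sum fun l _ => hW l
  linarith

/-- Comparison of the values of a homogeneous negative definite function at two families of
vectors with standard covariance. The constant does not depend on the dimension. -/
theorem IsHomNegDefFun.le_of_isotropic (h : IsHomNegDefFun ψ r) (hr0 : 0 < r) (hr : r < 2)
    {j : ℕ} (w w' : (Fin j → Bool) → E)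
    (hw : ∀ x, ∑ l, ⟪w l, x⟫ ^ 2 = 2 ^ j * ‖x‖ ^ 2)
    (hw2 : ∀ x, ∑ l, ⟪w' l, x⟫ ^ 2 = 2 ^ j * ‖x‖ ^ 2)
    (hw4 : ∀ x, ∑ l, ⟪w' l, x⟫ ^ 4 ≤ 2 ^ j * (9 * ‖x‖ ^ 4)) {a b : ℝ}
    (ha : ∀ l, ψ (w l) = a) (hb : ∀ l, ψ (w' l) = b) :
    (2 - 2 ^ (r / 2)) / 18 * a ≤ b := by
  have hcard : (Fintype.card (Fin j → Bool) : ℝ) = 2 ^ j := by simp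
  have h1 := h.sum_gaussianLine_le hr0 hr.le w hw
  have h2 := h.integral_stdGaussian_le hr0 hr.le w' (by rwa [hcard]) (by rwa [hcard])
  have havg : ∀ (v : (Fin j → Bool) → E) (c : ℝ), (∀ l, ψ (v l) = c) →
      (∑ l, ∫ y, ψ y ∂gaussianLine (v l)) / 2 ^ j = gaussianMoment r * c := by
    intro v c hc
    simp_rw [h.integral_gaussianLine_eq, hc]
    rw [Finset.sum_const, Finset.card_univ, nsmul_eq_mul, hcard,
      mul_div_cancel_left₀ _ (by positivity)]
  rw [havg w a ha] at h1
  rw [hcard, havg w' b hb] at h2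
  have hK : 0 ≤ (2 - (2 : ℝ) ^ (r / 2)) / 18 := by
    have : (2 : ℝ) ^ (r / 2) ≤ 2 ^ (1 : ℝ) :=
      Real.rpow_le_rpow_of_exponent_le (by norm_num) (by linarith)
    rw [Real.rpow_one] at this
    linarith
  have h3 := (mul_le_mul_of_nonneg_left h1 hK).trans h2
  rw [mul_left_comm] at h3
  exact le_of_mul_le_mul_left h3 (gaussianMoment_pos hr0 hr.le)

end GaussianAverages

/-! ### Matrices as operators on `H` and their singular values -/

section Schatten

open Matrix Module.End
open scoped InnerProductSpace ComplexOrder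

variable {𝕜 H : Type*} [RCLike 𝕜] [NormedAddCommGroup H] [InnerProductSpace 𝕜 H] [CompleteSpace H]
  {m : Type*} [Fintype m] [DecidableEq m]

theorem Matrix.IsHermitian.finrank_eigenspace_toEuclideanLin {G : Matrix m m 𝕜}
    (hG : G.IsHermitian) (μ : ℝ) :
    Module.finrank 𝕜 (eigenspace (toEuclideanLin G) (μ : 𝕜))
      = (Finset.univ.filter fun i => hG.eigenvalues i = μ).card := by
  rw [← (isSymmetric_toEuclideanLin_iff.mpr hG).card_filter_eigenvalues_eq finrank_euclideanSpace]
  refine Finset.card_equiv (Fintype.equivOfCardEq (Fintype.card_fin _)) fun i => ?_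
  rw [Finset.mem_filter_univ, Finset.mem_filter_univ, RCLike.ofReal_inj,
    Matrix.IsHermitian.eigenvalues, Matrix.IsHermitian.eigenvalues₀, Equiv.symm_apply_apply]

theorem Matrix.IsHermitian.trace_pow_eq_sum {G : Matrix m m 𝕜} (hG : G.IsHermitian) (k : ℕ) :
    (G ^ k).trace = ∑ i, ((hG.eigenvalues i ^ k : ℝ) : 𝕜) := by
  rw [← cfc_pow_id (R := ℝ) G k hG.isSelfAdjoint, hG.cfc_eq, IsHermitian.cfc,
    Unitary.conjStarAlgAut_apply, trace_mul_cycle, Unitary.coe_star_mul_self, one_mul,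
    trace_diagonal]
  rfl

/-- An eigenvector of `U M U*` for a nonzero eigenvalue lies in the range of `U`, so the eigenspaces
correspond under `U`. -/
theorem finrank_eigenspace_conj {F : Type*} [NormedAddCommGroup F] [InnerProductSpace 𝕜 F]
    [CompleteSpace F] (U : F →ₗᵢ[𝕜] H) (M : F →L[𝕜] F) {μ : 𝕜} (hμ : μ ≠ 0) :
    Module.finrank 𝕜 (eigenspace ((U.toContinuousLinearMap ∘L M ∘L
      ContinuousLinearMap.adjoint U.toContinuousLinearMap : H →L[𝕜] H) : H →ₗ[𝕜] H) μ)
      = Module.finrank 𝕜 (eigenspace (M : F →ₗ[𝕜] F) μ) := by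
  have hU : ∀ y, ContinuousLinearMap.adjoint U.toContinuousLinearMap (U y) = y := fun y =>
    congr($(U.adjoint_comp_self) y)
  have hmap : eigenspace ((U.toContinuousLinearMap ∘L M ∘L
      ContinuousLinearMap.adjoint U.toContinuousLinearMap : H →L[𝕜] H) : H →ₗ[𝕜] H) μ
      = (eigenspace (M : F →ₗ[𝕜] F) μ).map U.toLinearMap := by
    ext x
    simp only [mem_eigenspace_iff, Submodule.mem_map, ContinuousLinearMap.coe_coe,
      ContinuousLinearMap.comp_apply, LinearIsometry.coe_toContinuousLinearMap,
      LinearIsometry.coe_toLinearMap]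
    constructor
    · intro hx
      set z := M (ContinuousLinearMap.adjoint U.toContinuousLinearMap x) with hz
      have hx' : x = U (μ⁻¹ • z) := by
        rw [map_smul, hx, smul_smul, inv_mul_cancel₀ hμ, one_smul]
      refine ⟨μ⁻¹ • z, ?_, hx'.symm⟩
      have h1 : ContinuousLinearMap.adjoint U.toContinuousLinearMap x = μ⁻¹ • z := by
        conv_lhs => rw [hx']
        exact hU _
      rw [h1] at hz
      rw [← hz, smul_smul, mul_inv_cancel₀ hμ, one_smul]
    · rintro ⟨y, hy, rfl⟩
      rw [hU, hy, map_smul]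
  rw [hmap]
  exact (Submodule.equivMapOfInjective U.toLinearMap U.injective _).finrank_eq.symm

/-- The operator on `H` which acts on the range of the isometry `U` as the real matrix `A`, and
vanishes on the orthogonal complement of this range. -/
noncomputable def matrixOp (U : EuclideanSpace 𝕜 m →ₗᵢ[𝕜] H) (A : Matrix m m ℝ) : H →L[𝕜] H :=
  U.toContinuousLinearMap ∘L toEuclideanCLM (𝕜 := 𝕜) (A.map (algebraMap ℝ 𝕜)) ∘L
    ContinuousLinearMap.adjoint U.toContinuousLinearMap

variable (U : EuclideanSpace 𝕜 m →ₗᵢ[𝕜] H)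

theorem matrixOp_sub (A B : Matrix m m ℝ) : matrixOp U (A - B) = matrixOp U A - matrixOp U B := by
  have : (A - B).map (algebraMap ℝ 𝕜) = A.map (algebraMap ℝ 𝕜) - B.map (algebraMap ℝ 𝕜) := by
    ext i j
    simp
  rw [matrixOp, this, map_sub, ContinuousLinearMap.sub_comp, ContinuousLinearMap.comp_sub]
  rfl

theorem matrixOp_add (A B : Matrix m m ℝ) : matrixOp U (A + B) = matrixOp U A + matrixOp U B := by
  have : (A + B).map (algebraMap ℝ 𝕜) = A.map (algebraMap ℝ 𝕜) + B.map (algebraMap ℝ 𝕜) := by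
    ext i j
    simp
  rw [matrixOp, this, map_add, ContinuousLinearMap.add_comp, ContinuousLinearMap.comp_add]
  rfl

theorem matrixOp_smul (t : ℝ) (A : Matrix m m ℝ) :
    matrixOp U (t • A) = (t : 𝕜) • matrixOp U A := by
  have : (t • A).map (algebraMap ℝ 𝕜) = (t : 𝕜) • A.map (algebraMap ℝ 𝕜) := by
    ext i j
    simp
  rw [matrixOp, this, map_smul, ContinuousLinearMap.smul_comp, ContinuousLinearMap.comp_smul]
  rfl

/-- The Gram matrix `Aᴴ A` over `𝕜` of a real matrix `A`. -/
noncomputable def gramMatrix (𝕜 : Type*) [RCLike 𝕜] (A : Matrix m m ℝ) : Matrix m m 𝕜 :=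
  (A.map (algebraMap ℝ 𝕜))ᴴ * A.map (algebraMap ℝ 𝕜)

omit [DecidableEq m] in
theorem gramMatrix_eq_map (A : Matrix m m ℝ) :
    gramMatrix 𝕜 A = (Aᵀ * A).map (algebraMap ℝ 𝕜) := by
  rw [gramMatrix, Matrix.map_mul]
  congr 1
  ext i j
  simp

omit [DecidableEq m] in
theorem isHermitian_gramMatrix (A : Matrix m m ℝ) : (gramMatrix 𝕜 A).IsHermitian :=
  isHermitian_conjTranspose_mul_self _

/-- The eigenvalues of `Aᴴ A`. -/
noncomputable def gramEigenvalues (𝕜 : Type*) [RCLike 𝕜] (A : Matrix m m ℝ) : m → ℝ :=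
  (isHermitian_gramMatrix (𝕜 := 𝕜) A).eigenvalues

theorem gramEigenvalues_nonneg (A : Matrix m m ℝ) (i : m) : 0 ≤ gramEigenvalues 𝕜 A i :=
  (posSemidef_conjTranspose_mul_self (A.map (algebraMap ℝ 𝕜))).eigenvalues_nonneg i

theorem adjoint_comp_matrixOp (A : Matrix m m ℝ) :
    ContinuousLinearMap.adjoint (matrixOp U A) ∘L matrixOp U A
      = U.toContinuousLinearMap ∘L toEuclideanCLM (𝕜 := 𝕜) (gramMatrix 𝕜 A) ∘L
        ContinuousLinearMap.adjoint U.toContinuousLinearMap := by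
  have hU : ∀ y, ContinuousLinearMap.adjoint U.toContinuousLinearMap
      (U.toContinuousLinearMap y) = y := fun y => congr($(U.adjoint_comp_self) y)
  have hstar : ContinuousLinearMap.adjoint (toEuclideanCLM (𝕜 := 𝕜) (A.map (algebraMap ℝ 𝕜)))
      = toEuclideanCLM (𝕜 := 𝕜) (A.map (algebraMap ℝ 𝕜))ᴴ :=
    (map_star (toEuclideanCLM (n := m) (𝕜 := 𝕜)) (A.map (algebraMap ℝ 𝕜))).symm
  ext x
  simp only [matrixOp, ContinuousLinearMap.adjoint_comp, ContinuousLinearMap.adjoint_adjoint,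
    ContinuousLinearMap.comp_apply, hU, hstar, gramMatrix, map_mul, mul_apply_eq_comp]

theorem singularMultiplicity_matrixOp (A : Matrix m m ℝ) {s : ℝ} (hs : 0 < s) :
    singularMultiplicity (matrixOp U A) s
      = (Finset.univ.filter fun i => gramEigenvalues 𝕜 A i = s ^ 2).card := by
  rw [singularMultiplicity, adjoint_comp_matrixOp, finrank_eigenspace_conj,
    coe_toEuclideanCLM_eq_toEuclideanLin,
    (isHermitian_gramMatrix (𝕜 := 𝕜) A).finrank_eigenspace_toEuclideanLin]
  · rfl
  · exact_mod_cast (pow_pos hs 2).ne'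

/-- Exchanging the sum over `s > 0` with the finite sum over eigenvalues, each eigenvalue `λ > 0` is
met exactly once, at `s = √λ`; zero eigenvalues contribute nothing to either side. -/
theorem schattenSum_matrixOp {q : ℝ} (hq : 0 < q) (A : Matrix m m ℝ) :
    schattenSum q (matrixOp U A)
      = ENNReal.ofReal (∑ i, gramEigenvalues 𝕜 A i ^ (q / 2)) := by
  have h1 : ∀ s : Set.Ioi (0 : ℝ), (singularMultiplicity (matrixOp U A) s : ℝ≥0∞)
      * ENNReal.ofReal ((s : ℝ) ^ q)
      = ∑ i, if gramEigenvalues 𝕜 A i = (s : ℝ) ^ 2 then ENNReal.ofReal ((s : ℝ) ^ q) else 0 := by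
    intro s
    rw [singularMultiplicity_matrixOp U A s.2, Finset.sum_ite, Finset.sum_const_zero, add_zero,
      Finset.sum_const, nsmul_eq_mul]
  rw [schattenSum, ENNReal.ofReal_sum_of_nonneg
    fun i _ => Real.rpow_nonneg (gramEigenvalues_nonneg A i) _]
  simp_rw [h1]
  rw [Summable.tsum_finsetSum fun _ _ => ENNReal.summable]
  refine Finset.sum_congr rfl fun i _ => ?_
  have hnn := gramEigenvalues_nonneg (𝕜 := 𝕜) A i
  rcases hnn.eq_or_lt with h0 | hpos
  · rw [← h0, Real.zero_rpow (by positivity), ENNReal.ofReal_zero, ENNReal.tsum_eq_zero]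
    intro s
    have : (0 : ℝ) < s := s.2
    rw [if_neg (by positivity)]
  · rw [tsum_eq_single ⟨√(gramEigenvalues 𝕜 A i), Real.sqrt_pos.2 hpos⟩]
    · simp only [Real.sq_sqrt hnn, if_true]
      rw [Real.sqrt_eq_rpow, ← Real.rpow_mul hnn]
      congr 2
      ring
    · intro s hs
      rw [if_neg]
      intro h
      refine hs (Subtype.ext ?_)
      simp only [h]
      rw [Real.sqrt_sq (le_of_lt s.2)]

theorem isSchatten_matrixOp {q : ℝ≥0∞} (hq : 0 < q) (A : Matrix m m ℝ) :
    IsSchatten q (matrixOp U A) := by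
  refine ⟨?_, fun hq' => ?_⟩
  · have h : IsCompactOperator (toEuclideanCLM (𝕜 := 𝕜) (A.map (algebraMap ℝ 𝕜))) := by
      refine ⟨Metric.closedBall 0 1 |> fun s =>
        (toEuclideanCLM (𝕜 := 𝕜) (A.map (algebraMap ℝ 𝕜))) '' s, ?_, ?_⟩
      · exact (ProperSpace.isCompact_closedBall (0 : EuclideanSpace 𝕜 m) 1).image
          (ContinuousLinearMap.continuous _)
      · exact Filter.mem_of_superset (Metric.closedBall_mem_nhds 0 one_pos)
          (Set.subset_preimage_image _ _)
    exact (h.comp_clm _).clm_comp U.toContinuousLinearMap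
  · rw [schattenSum_matrixOp U (ENNReal.toReal_pos hq.ne' hq')]
    exact ENNReal.ofReal_lt_top

theorem schattenNorm_matrixOp {q : ℝ≥0∞} (hq : 0 < q) (hq' : q ≠ ∞) (A : Matrix m m ℝ) :
    schattenNorm q (matrixOp U A)
      = (∑ i, gramEigenvalues 𝕜 A i ^ (q.toReal / 2)) ^ (1 / q.toReal) := by
  rw [schattenNorm, if_neg hq', schattenSum_matrixOp U (ENNReal.toReal_pos hq.ne' hq'),
    ENNReal.toReal_ofReal]
  exact Finset.sum_nonneg fun i _ => Real.rpow_nonneg (gramEigenvalues_nonneg A i) _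

theorem sum_gramEigenvalues_pow (A : Matrix m m ℝ) (k : ℕ) :
    ∑ i, gramEigenvalues 𝕜 A i ^ k = ((Aᵀ * A) ^ k).trace := by
  have h := (isHermitian_gramMatrix (𝕜 := 𝕜) A).trace_pow_eq_sum k
  have h2 : (gramMatrix 𝕜 A ^ k).trace = ((((Aᵀ * A) ^ k).trace : ℝ) : 𝕜) := by
    rw [gramMatrix_eq_map, ← RingHom.mapMatrix_apply, ← map_pow, RingHom.mapMatrix_apply]
    simp [Matrix.trace]
  rw [h2, ← RCLike.ofReal_sum] at h
  exact (RCLike.ofReal_injective h).symm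

theorem sum_gramEigenvalues (A : Matrix m m ℝ) :
    ∑ i, gramEigenvalues 𝕜 A i = (Aᵀ * A).trace := by
  simpa using sum_gramEigenvalues_pow (𝕜 := 𝕜) A 1

/-- For a polynomial the sum is a combination of the traces of powers of `AᵀA`, hence continuous in
`A`. Where the trace of `AᵀA` is bounded, all eigenvalues stay in one compact interval, and
Weierstrass approximation of `f` there is uniform; continuity of the individual eigenvalues is not
needed. -/
theorem continuous_sum_gramEigenvalues {f : ℝ → ℝ} (hf : Continuous f) :
    Continuous fun A : Matrix m m ℝ => ∑ i, f (gramEigenvalues 𝕜 A i) := by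
  have htr : Continuous fun A : Matrix m m ℝ => (Aᵀ * A).trace := by fun_prop
  refine continuous_of_locally_uniform_approx_of_continuousAt fun A u hu => ?_
  obtain ⟨ε, hε, hεu⟩ := Metric.mem_uniformity_dist.1 hu
  set R := (Aᵀ * A).trace + 1 with hR
  obtain ⟨P, hP⟩ := exists_polynomial_near_of_continuousOn 0 R f hf.continuousOn
    (ε / (Fintype.card m + 1)) (by positivity)
  refine ⟨{B | (Bᵀ * B).trace < R}, (isOpen_lt htr continuous_const).mem_nhds (by simp [hR]),
    fun B => ∑ i, P.eval (gramEigenvalues 𝕜 B i), ?_, fun B hB => hεu ?_⟩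
  · have e : (fun B : Matrix m m ℝ => ∑ i, P.eval (gramEigenvalues 𝕜 B i))
        = fun B => ∑ k ∈ Finset.range (P.natDegree + 1), P.coeff k * ((Bᵀ * B) ^ k).trace := by
      funext B
      simp_rw [Polynomial.eval_eq_sum_range]
      rw [Finset.sum_comm]
      refine Finset.sum_congr rfl fun k _ => ?_
      rw [← Finset.mul_sum, sum_gramEigenvalues_pow]
    rw [e]
    exact Continuous.continuousAt (by fun_prop)
  · have hmem : ∀ i, gramEigenvalues 𝕜 B i ∈ Set.Icc 0 R := by
      intro i
      refine ⟨gramEigenvalues_nonneg B i, ?_⟩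
      have h1 : gramEigenvalues 𝕜 B i ≤ ∑ i, gramEigenvalues 𝕜 B i :=
        Finset.single_le_sum (fun j _ => gramEigenvalues_nonneg B j) (Finset.mem_univ i)
      rw [sum_gramEigenvalues] at h1
      exact h1.trans (le_of_lt hB)
    rw [Real.dist_eq, ← Finset.sum_sub_distrib]
    calc _ ≤ ∑ i, |f (gramEigenvalues 𝕜 B i) - P.eval (gramEigenvalues 𝕜 B i)| :=
          Finset.abs_sum_le_sum_abs _ _
      _ ≤ ∑ _i : m, ε / (Fintype.card m + 1) := by
          refine Finset.sum_le_sum fun i _ => ?_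
          rw [abs_sub_comm]
          exact (hP _ (hmem i)).le
      _ < ε := by
          rw [Finset.sum_const, Finset.card_univ, nsmul_eq_mul, mul_div_assoc',
            div_lt_iff₀ (by positivity)]
          nlinarith

theorem continuous_schattenNorm_matrixOp {q : ℝ≥0∞} (hq : 0 < q) :
    Continuous fun A : Matrix m m ℝ => schattenNorm q (matrixOp U A) := by
  by_cases hq' : q = ∞
  · simp only [schattenNorm, if_pos hq']
    let _ : NormedSpace ℝ (H →L[𝕜] H) := NormedSpace.restrictScalars ℝ 𝕜 (H →L[𝕜] H)
    let L : Matrix m m ℝ →ₗ[ℝ] (H →L[𝕜] H) :=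
      { toFun := matrixOp U
        map_add' := matrixOp_add U
        map_smul' := matrixOp_smul U }
    exact (LinearMap.continuous_of_finiteDimensional L).norm
  · simp_rw [schattenNorm_matrixOp U hq hq']
    have hpos := ENNReal.toReal_pos hq.ne' hq'
    exact (continuous_sum_gramEigenvalues (Real.continuous_rpow_const (by positivity))).rpow_const
      fun _ => Or.inr (by positivity)

end Schatten

/-! ### Homogeneity of the Schatten norm and its explicit values -/

section SchattenValues

open Matrix Module.End
open scoped InnerProductSpace ComplexOrder

variable {𝕜 H : Type*} [RCLike 𝕜] [NormedAddCommGroup H] [InnerProductSpace 𝕜 H] [CompleteSpace H]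

theorem singularMultiplicity_zero {s : ℝ} (hs : 0 < s) :
    singularMultiplicity (0 : H →L[𝕜] H) s = 0 := by
  have h : eigenspace (((ContinuousLinearMap.adjoint (0 : H →L[𝕜] H) ∘L 0 : H →L[𝕜] H)) :
      H →ₗ[𝕜] H) ((s ^ 2 : ℝ) : 𝕜) = ⊥ := by
    rw [Submodule.eq_bot_iff]
    intro x hx
    rw [mem_eigenspace_iff] at hx
    have hs' : ((s ^ 2 : ℝ) : 𝕜) ≠ 0 := by exact_mod_cast (pow_pos hs 2).ne'
    simpa [hs.ne'] using hx.symm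
  rw [singularMultiplicity, h, finrank_bot]

theorem singularMultiplicity_smul (T : H →L[𝕜] H) {t : ℝ} (ht : t ≠ 0) (s : ℝ) :
    singularMultiplicity ((t : 𝕜) • T) (|t| * s) = singularMultiplicity T s := by
  have ht' : (t : 𝕜) ≠ 0 := by exact_mod_cast ht
  have h : eigenspace ((ContinuousLinearMap.adjoint ((t : 𝕜) • T) ∘L ((t : 𝕜) • T) : H →L[𝕜] H) :
      H →ₗ[𝕜] H) (((|t| * s) ^ 2 : ℝ) : 𝕜)
      = eigenspace ((ContinuousLinearMap.adjoint T ∘L T : H →L[𝕜] H) : H →ₗ[𝕜] H)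
        ((s ^ 2 : ℝ) : 𝕜) := by
    ext x
    simp only [mem_eigenspace_iff, ContinuousLinearMap.coe_coe, ContinuousLinearMap.comp_apply,
      map_smulₛₗ, _root_.smul_apply, RCLike.conj_ofReal, RingHom.id_apply]
    rw [smul_smul, mul_pow, sq_abs, RCLike.ofReal_mul, ← RCLike.ofReal_mul, ← sq, mul_smul]
    refine ⟨fun hx => ?_, fun hx => by rw [hx]⟩
    exact smul_right_injective H (r := ((t ^ 2 : ℝ) : 𝕜)) (by exact_mod_cast pow_ne_zero 2 ht) hx
  rw [singularMultiplicity, h, singularMultiplicity]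

theorem schattenSum_smul (q : ℝ) (T : H →L[𝕜] H) {t : ℝ} (ht : t ≠ 0) :
    schattenSum q ((t : 𝕜) • T) = ENNReal.ofReal (|t| ^ q) * schattenSum q T := by
  have ht' : 0 < |t| := abs_pos.2 ht
  let e : Set.Ioi (0 : ℝ) ≃ Set.Ioi (0 : ℝ) :=
    { toFun := fun s => ⟨|t| * s, mul_pos ht' s.2⟩
      invFun := fun s => ⟨|t|⁻¹ * s, mul_pos (inv_pos.2 ht') s.2⟩
      left_inv := fun s => Subtype.ext (by simp [ht'.ne'])
      right_inv := fun s => Subtype.ext (by simp [ht'.ne']) }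
  rw [schattenSum, ← e.tsum_eq, schattenSum, ← ENNReal.tsum_mul_left]
  refine tsum_congr fun s => ?_
  simp only [e, Equiv.coe_fn_mk]
  rw [singularMultiplicity_smul T ht, Real.mul_rpow ht'.le (le_of_lt s.2),
    ENNReal.ofReal_mul (Real.rpow_nonneg ht'.le q)]
  ring

theorem schattenNorm_nonneg (q : ℝ≥0∞) (T : H →L[𝕜] H) : 0 ≤ schattenNorm q T := by
  rw [schattenNorm]
  split_ifs
  · exact norm_nonneg T
  · exact Real.rpow_nonneg ENNReal.toReal_nonneg _

theorem schattenNorm_zero {q : ℝ≥0∞} (hq : 0 < q) : schattenNorm q (0 : H →L[𝕜] H) = 0 := by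
  rw [schattenNorm]
  split_ifs with hq'
  · exact norm_zero
  · have hpos := ENNReal.toReal_pos hq.ne' hq'
    have h : schattenSum q.toReal (0 : H →L[𝕜] H) = 0 := by
      rw [schattenSum, ENNReal.tsum_eq_zero]
      intro s
      rw [singularMultiplicity_zero s.2]
      simp
    rw [h, ENNReal.toReal_zero, Real.zero_rpow (by positivity)]

theorem schattenNorm_smul {q : ℝ≥0∞} (hq : 0 < q) (t : ℝ) (T : H →L[𝕜] H) :
    schattenNorm q ((t : 𝕜) • T) = |t| * schattenNorm q T := by
  by_cases ht : t = 0
  · simp [ht, schattenNorm_zero hq]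
  · rw [schattenNorm, schattenNorm]
    split_ifs with hq'
    · rw [norm_smul, RCLike.norm_ofReal]
    · have hpos := ENNReal.toReal_pos hq.ne' hq'
      rw [schattenSum_smul _ T ht, ENNReal.toReal_mul,
        ENNReal.toReal_ofReal (Real.rpow_nonneg (abs_nonneg t) _),
        Real.mul_rpow (Real.rpow_nonneg (abs_nonneg t) _) ENNReal.toReal_nonneg,
        ← Real.rpow_mul (abs_nonneg t), mul_one_div_cancel hpos.ne', Real.rpow_one]

theorem schattenDist_comm {q : ℝ≥0∞} (hq : 0 < q) (S T : SchattenClass 𝕜 H q) :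
    schattenDist q S T = schattenDist q T S := by
  have h := schattenNorm_smul hq (-1) (T.1 - S.1)
  have e : (((-1 : ℝ) : 𝕜) • (T.1 - S.1)) = S.1 - T.1 := by
    rw [RCLike.ofReal_neg, RCLike.ofReal_one, neg_one_smul, neg_sub]
  rw [e, abs_neg, abs_one, one_mul] at h
  rw [schattenDist, schattenDist, h]

variable {m : Type*} [Fintype m] [DecidableEq m] (U : EuclideanSpace 𝕜 m →ₗᵢ[𝕜] H)

theorem adjoint_comp_matrixOp_self (A : Matrix m m ℝ) :
    ContinuousLinearMap.adjoint (matrixOp U A) ∘L matrixOp U A = matrixOp U (Aᵀ * A) := by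
  rw [adjoint_comp_matrixOp, gramMatrix_eq_map, matrixOp]

theorem matrixOp_eq_zero {A : Matrix m m ℝ} (h : matrixOp U A = 0) : A = 0 := by
  have hU : ∀ y, ContinuousLinearMap.adjoint U.toContinuousLinearMap
      (U.toContinuousLinearMap y) = y := fun y => congr($(U.adjoint_comp_self) y)
  have h1 : toEuclideanCLM (𝕜 := 𝕜) (A.map (algebraMap ℝ 𝕜)) = 0 := by
    ext1 y
    have h2 : matrixOp U A (U y) = 0 := by rw [h]; rfl
    have h3 : U (toEuclideanCLM (𝕜 := 𝕜) (A.map (algebraMap ℝ 𝕜)) y) = 0 := by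
      rw [← h2]
      change _ = U (toEuclideanCLM (𝕜 := 𝕜) (A.map (algebraMap ℝ 𝕜))
        (ContinuousLinearMap.adjoint U.toContinuousLinearMap (U.toContinuousLinearMap y)))
      rw [hU]
    exact U.injective (h3.trans (map_zero U).symm)
  have h2 : A.map (algebraMap ℝ 𝕜) = 0 := by
    exact (toEuclideanCLM (n := m) (𝕜 := 𝕜)).injective (h1.trans (map_zero _).symm)
  ext i j
  have := congrFun (congrFun h2 i) j
  simpa using this

/-- If `AᵀA` is a multiple `c` of a projection then `A` has `tr (AᵀA) / c` singular values `√c`. -/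
theorem schattenNorm_matrixOp_of_sq_eq {q : ℝ≥0∞} (hq : 0 < q) {A : Matrix m m ℝ} {c τ : ℝ}
    (hc : 0 < c) (hA : Aᵀ * A * (Aᵀ * A) = c • (Aᵀ * A)) (hτ : (Aᵀ * A).trace = τ) (hτ0 : 0 < τ) :
    schattenNorm q (matrixOp U A) = √c * (τ / c) ^ (1 / q.toReal) := by
  by_cases hq' : q = ∞
  -- Here `q.toReal = 0` and `1 / 0 = 0`, so the second factor is `1`. The value `√c` of the
  -- operator norm follows from the `C*`-identity for `A` and for `AᵀA`.
  · rw [schattenNorm, if_pos hq', hq', ENNReal.toReal_top, div_zero, Real.rpow_zero, mul_one]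
    have h1 := ContinuousLinearMap.norm_adjoint_comp_self (matrixOp U A)
    have h2 := ContinuousLinearMap.norm_adjoint_comp_self (matrixOp U (Aᵀ * A))
    rw [adjoint_comp_matrixOp_self] at h1 h2
    rw [transpose_mul, transpose_transpose, hA, matrixOp_smul, norm_smul, RCLike.norm_ofReal,
      abs_of_pos hc] at h2
    have h3 : ‖matrixOp U (Aᵀ * A)‖ ≠ 0 := by
      intro h0
      rw [norm_eq_zero] at h0
      rw [matrixOp_eq_zero U h0] at hτ
      simp only [trace_zero] at hτ
      exact hτ0.ne hτ
    have h4 := mul_right_cancel₀ h3 h2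
    rw [h4, h1, Real.sqrt_mul_self (norm_nonneg _)]
  · have hpos := ENNReal.toReal_pos hq.ne' hq'
    rw [schattenNorm_matrixOp U hq hq']
    set G := Aᵀ * A with hG
    have p2 : G ^ 2 = c • G := by rw [sq, hA]
    have p3 : G ^ 3 = c ^ 2 • G := by
      rw [pow_succ, p2, smul_mul_assoc, hA, smul_smul, sq]
    have p4 : G ^ 4 = c ^ 3 • G := by
      rw [pow_succ, p3, smul_mul_assoc, hA, smul_smul]
      congr 1
    -- Each eigenvalue is `0` or `c`: the sum of squares `∑ (λ² - c λ)²` is a combination of traces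
    -- of powers of `G`, and vanishes because `G² = c G`.
    have hsum : ∑ i, (gramEigenvalues 𝕜 A i ^ 2 - c * gramEigenvalues 𝕜 A i) ^ 2 = 0 := by
      have e : ∀ x : ℝ, (x ^ 2 - c * x) ^ 2 = x ^ 4 - 2 * c * x ^ 3 + c ^ 2 * x ^ 2 :=
        fun x => by ring
      simp_rw [e, Finset.sum_add_distrib, Finset.sum_sub_distrib, ← Finset.mul_sum,
        sum_gramEigenvalues_pow]
      rw [← hG, p2, p3, p4]
      simp only [trace_smul, smul_eq_mul]
      ring
    rw [Finset.sum_eq_zero_iff_of_nonneg fun _ _ => sq_nonneg _] at hsum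
    have hterm : ∀ i, gramEigenvalues 𝕜 A i ^ (q.toReal / 2)
        = c ^ (q.toReal / 2) / c * gramEigenvalues 𝕜 A i := by
      intro i
      have h1 := hsum i (Finset.mem_univ i)
      have h2 : gramEigenvalues 𝕜 A i * (gramEigenvalues 𝕜 A i - c) = 0 := by
        have := pow_eq_zero_iff (two_ne_zero) |>.1 h1
        linarith
      rcases mul_eq_zero.1 h2 with h | h
      · rw [h, Real.zero_rpow (by positivity), mul_zero]
      · rw [sub_eq_zero.1 h, div_mul_cancel₀ _ hc.ne']
    simp_rw [hterm]
    rw [← Finset.mul_sum, sum_gramEigenvalues, hτ, div_mul_eq_mul_div, mul_div_assoc,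
      Real.mul_rpow (by positivity) (by positivity), ← Real.rpow_mul hc.le, Real.sqrt_eq_rpow]
    congr 2
    field_simp

end SchattenValues

/-! ### Negative type of `C_q` as negative definiteness on matrices -/

section NegativeTypeOfFamilies

/-- Weights at repeated points are amalgamated, so the points of the family need not be distinct. -/
theorem IsNegativeType.sum_nonpos {X : Type*} {d : X → X → ℝ} {p : ℝ} (h : IsNegativeType d p)
    {ι : Type*} [Fintype ι] (x : ι → X) (ξ : ι → ℝ) (hξ : ∑ i, ξ i = 0) :
    ∑ i, ∑ j, ξ i * ξ j * powDist d p (x i) (x j) ≤ 0 := by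
  classical
  set S := Finset.univ.image x with hS
  set ζ : X → ℝ := fun z => ∑ i, if x i = z then ξ i else 0 with hζ
  have hsum : ∀ f : X → ℝ, ∑ z ∈ S, ζ z * f z = ∑ i, ξ i * f (x i) := by
    intro f
    simp only [hζ, Finset.sum_mul]
    rw [Finset.sum_comm]
    refine Finset.sum_congr rfl fun i _ => ?_
    simp [ite_mul, hS]
  have h1 := h S ζ (by simpa [hξ] using hsum fun _ => 1)
  refine le_of_eq_of_le ?_ h1
  have e1 : ∀ z, ∑ w ∈ S, powDist d p z w * ζ z * ζ w = ζ z * ∑ i, ξ i * powDist d p z (x i) := by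
    intro z
    rw [← hsum, Finset.mul_sum]
    exact Finset.sum_congr rfl fun w _ => by ring
  simp_rw [e1]
  rw [hsum]
  refine Finset.sum_congr rfl fun i _ => ?_
  rw [Finset.mul_sum]
  exact Finset.sum_congr rfl fun j _ => by ring

end NegativeTypeOfFamilies

section SchattenNegativeType

variable {𝕜 H : Type*} [RCLike 𝕜] [NormedAddCommGroup H] [InnerProductSpace 𝕜 H] [CompleteSpace H]
  {m : Type*} [Fintype m] [DecidableEq m]

/-- The vector of entries of a matrix. -/
noncomputable def matrixVec (A : Matrix m m ℝ) : EuclideanSpace ℝ (m × m) :=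
  WithLp.toLp 2 fun z => A z.1 z.2

/-- The power `‖A‖_q ^ r` of the Schatten norm, as a function of the entries of a real matrix. -/
noncomputable def schattenFun (q : ℝ≥0∞) (r : ℝ) (U : EuclideanSpace 𝕜 m →ₗᵢ[𝕜] H)
    (v : EuclideanSpace ℝ (m × m)) : ℝ :=
  schattenNorm q (matrixOp U (Matrix.of fun i j => v (i, j))) ^ r

theorem schattenFun_matrixVec (q : ℝ≥0∞) (r : ℝ) (U : EuclideanSpace 𝕜 m →ₗᵢ[𝕜] H)
    (A : Matrix m m ℝ) : schattenFun q r U (matrixVec A) = schattenNorm q (matrixOp U A) ^ r := rfl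

/-- Embedded matrices lie in `C_q`, and their distance to the power `p` is a function of the
difference. The exponent `min(1, q) p` absorbs the power in the metric for `q < 1`, so both ranges
of `q` are treated alike. -/
theorem isHomNegDefFun_schattenFun {q : ℝ≥0∞} (hq : 0 < q) {p : ℝ} (hp : 0 < p)
    (h : IsNegativeType (schattenDist q : SchattenClass 𝕜 H q → SchattenClass 𝕜 H q → ℝ) p)
    (U : EuclideanSpace 𝕜 m →ₗᵢ[𝕜] H) :
    IsHomNegDefFun (schattenFun q ((min 1 q).toReal * p) U) ((min 1 q).toReal * p) := by
  have hmin : 0 < (min 1 q).toReal :=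
    ENNReal.toReal_pos (lt_min one_pos hq).ne' (min_lt_of_left_lt ENNReal.one_lt_top).ne
  have hr : 0 < (min 1 q).toReal * p := mul_pos hmin hp
  refine ⟨?_, fun t v => ?_, fun ι _ s ξ hξ => ?_⟩
  · have h1 : Continuous fun v : EuclideanSpace ℝ (m × m) =>
        (Matrix.of fun i j => v (i, j) : Matrix m m ℝ) := by
      refine continuous_matrix fun i j => ?_
      simp only [Matrix.of_apply]
      fun_prop
    exact ((continuous_schattenNorm_matrixOp U hq).comp h1).rpow_const fun _ => Or.inr hr.le
  · have e : (Matrix.of fun i j => (t • v) (i, j) : Matrix m m ℝ)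
        = t • Matrix.of fun i j => v (i, j) := by
      ext i j
      simp
    rw [schattenFun, e, matrixOp_smul, schattenNorm_smul hq,
      Real.mul_rpow (abs_nonneg t) (schattenNorm_nonneg q _), schattenFun]
  · let S : ι → SchattenClass 𝕜 H q := fun i =>
      ⟨matrixOp U (Matrix.of fun a b => s i (a, b)), isSchatten_matrixOp U hq _⟩
    refine le_of_eq_of_le ?_ (h.sum_nonpos S ξ hξ)
    refine Finset.sum_congr rfl fun i _ => Finset.sum_congr rfl fun j _ => ?_
    congr 1
    have e : schattenFun q ((min 1 q).toReal * p) U (s i - s j)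
        = schattenNorm q ((S i).1 - (S j).1) ^ ((min 1 q).toReal * p) := by
      rw [schattenFun]
      congr 2
      rw [← matrixOp_sub]
      rfl
    rw [e, powDist]
    split_ifs with hij
    · rw [hij, sub_self, schattenNorm_zero hq, Real.zero_rpow hr.ne']
    · rw [schattenDist, Real.rpow_mul (schattenNorm_nonneg q _)]

omit [CompleteSpace H] in
theorem exists_linearIsometry_of_not_finiteDimensional (hH : ¬ FiniteDimensional 𝕜 H)
    (m : Type*) [Fintype m] : Nonempty (EuclideanSpace 𝕜 m →ₗᵢ[𝕜] H) := by
  have hrank : (Fintype.card m : Cardinal) ≤ Module.rank 𝕜 H := by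
    have : Cardinal.aleph0 ≤ Module.rank 𝕜 H := by
      by_contra hlt
      exact hH (Module.rank_lt_aleph0_iff.1 (not_le.1 hlt))
    exact (Cardinal.natCast_lt_aleph0.le).trans this
  obtain ⟨v, hv⟩ := exists_linearIndependent_of_le_rank hrank
  set V := Submodule.span 𝕜 (Set.range v) with hV
  have hfin : Module.finrank 𝕜 V = Fintype.card m := by
    rw [hV, finrank_span_eq_card hv, Fintype.card_fin]
  have : FiniteDimensional 𝕜 V := FiniteDimensional.span_of_finite 𝕜 (Set.finite_range v)
  let b : OrthonormalBasis m 𝕜 V := (stdOrthonormalBasis 𝕜 V).reindex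
    (Fintype.equivOfCardEq (by rw [Fintype.card_fin, hfin]))
  exact ⟨V.subtypeₗᵢ.comp b.repr.symm.toLinearIsometry⟩

end SchattenNegativeType

/-! ### Random signs on rows and columns: second and fourth moments -/

section Signs

/-- The sign `1` or `-1` of a Boolean. -/
def boolSign (b : Bool) : ℝ := if b then 1 else -1

theorem boolSign_not (b : Bool) : boolSign (!b) = -boolSign b := by
  cases b <;> simp [boolSign]

theorem boolSign_sq (b : Bool) : boolSign b ^ 2 = 1 := by
  cases b <;> simp [boolSign]

variable {m : Type*} [Fintype m] [DecidableEq m]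

/-- A sign that is not involved in `f` averages out. -/
theorem sum_boolSign_mul_eq_zero (i : m) (f : (m → Bool) → ℝ)
    (hf : ∀ ε, f (Function.update ε i (!ε i)) = f ε) : ∑ ε, boolSign (ε i) * f ε = 0 := by
  let e : Equiv.Perm (m → Bool) := Function.Involutive.toPerm
    (fun ε => Function.update ε i (!ε i)) fun ε => by simp
  have h : ∑ ε, boolSign (ε i) * f ε = ∑ ε, -(boolSign (ε i) * f ε) := by
    rw [← Equiv.sum_comp e]
    refine Finset.sum_congr rfl fun ε _ => ?_
    change boolSign (Function.update ε i (!ε i) i) * f (Function.update ε i (!ε i)) = _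
    rw [hf, Function.update_self, boolSign_not, neg_mul]
  rw [Finset.sum_neg_distrib] at h
  linarith

omit [Fintype m] in
theorem sum_boolSign_update {s : Finset m} {i : m} (hi : i ∉ s) (a : m → ℝ) (ε : m → Bool)
    (b : Bool) :
    ∑ j ∈ s, boolSign (Function.update ε i b j) * a j = ∑ j ∈ s, boolSign (ε j) * a j := by
  refine Finset.sum_congr rfl fun j hj => ?_
  rw [Function.update_of_ne (ne_of_mem_of_not_mem hj hi)]

theorem sum_sq_sum_boolSign (a : m → ℝ) (s : Finset m) :
    ∑ ε : m → Bool, (∑ i ∈ s, boolSign (ε i) * a i) ^ 2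
      = 2 ^ Fintype.card m * ∑ i ∈ s, a i ^ 2 := by
  induction s using Finset.induction_on with
  | empty => simp
  | insert i s hi ih =>
    have h1 := sum_boolSign_mul_eq_zero i (fun ε => ∑ j ∈ s, boolSign (ε j) * a j)
      fun ε => sum_boolSign_update hi a ε _
    have e : ∀ ε : m → Bool, (∑ j ∈ insert i s, boolSign (ε j) * a j) ^ 2
        = a i ^ 2 + 2 * a i * (boolSign (ε i) * ∑ j ∈ s, boolSign (ε j) * a j)
          + (∑ j ∈ s, boolSign (ε j) * a j) ^ 2 := by
      intro ε
      rw [Finset.sum_insert hi]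
      linear_combination a i ^ 2 * boolSign_sq (ε i)
    simp_rw [e, Finset.sum_add_distrib, ← Finset.mul_sum, h1, ih, Finset.sum_insert hi]
    simp [mul_add]

/-- Khintchine's inequality for exponent four. On adding a sign, the odd powers of that sign average
out, and the cross term `6 a_i² ∑ a_j²` is exactly that of `3 (a_i² + ∑ a_j²)²`. -/
theorem sum_pow_four_sum_boolSign_le (a : m → ℝ) (s : Finset m) :
    ∑ ε : m → Bool, (∑ i ∈ s, boolSign (ε i) * a i) ^ 4
      ≤ 2 ^ Fintype.card m * (3 * (∑ i ∈ s, a i ^ 2) ^ 2) := by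
  induction s using Finset.induction_on with
  | empty => simp
  | insert i s hi ih =>
    have h1 := sum_boolSign_mul_eq_zero i (fun ε => ∑ j ∈ s, boolSign (ε j) * a j)
      fun ε => sum_boolSign_update hi a ε _
    have h3 := sum_boolSign_mul_eq_zero i (fun ε => (∑ j ∈ s, boolSign (ε j) * a j) ^ 3)
      fun ε => by rw [sum_boolSign_update hi a ε _]
    have h2 := sum_sq_sum_boolSign a s
    have e : ∀ ε : m → Bool, (∑ j ∈ insert i s, boolSign (ε j) * a j) ^ 4
        = a i ^ 4 + 4 * a i ^ 3 * (boolSign (ε i) * ∑ j ∈ s, boolSign (ε j) * a j)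
          + 6 * a i ^ 2 * (∑ j ∈ s, boolSign (ε j) * a j) ^ 2
          + 4 * a i * (boolSign (ε i) * (∑ j ∈ s, boolSign (ε j) * a j) ^ 3)
          + (∑ j ∈ s, boolSign (ε j) * a j) ^ 4 := by
      intro ε
      rw [Finset.sum_insert hi]
      linear_combination (a i ^ 4 * (boolSign (ε i) ^ 2 + 1)
        + 4 * a i ^ 3 * boolSign (ε i) * (∑ j ∈ s, boolSign (ε j) * a j)
        + 6 * a i ^ 2 * (∑ j ∈ s, boolSign (ε j) * a j) ^ 2) * boolSign_sq (ε i)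
    simp_rw [e, Finset.sum_add_distrib, ← Finset.mul_sum, h1, h2, h3, Finset.sum_insert hi]
    have hc : ∑ _ε : m → Bool, a i ^ 4 = 2 ^ Fintype.card m * a i ^ 4 := by simp
    rw [hc]
    have : 0 ≤ (2 : ℝ) ^ Fintype.card m * a i ^ 4 := by positivity
    nlinarith [ih]

/-- The matrix `A` with signs changed on some of its rows and columns. -/
def signMatrix (A : Matrix m m ℝ) (ε ε' : m → Bool) : Matrix m m ℝ :=
  Matrix.diagonal (fun i => boolSign (ε i)) * A * Matrix.diagonal fun j => boolSign (ε' j)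

theorem signMatrix_apply (A : Matrix m m ℝ) (ε ε' : m → Bool) (i j : m) :
    signMatrix A ε ε' i j = boolSign (ε i) * A i j * boolSign (ε' j) := by
  rw [signMatrix, Matrix.mul_diagonal, Matrix.diagonal_mul]

theorem diagonal_boolSign_mul_self (ε : m → Bool) :
    Matrix.diagonal (fun i => boolSign (ε i)) * Matrix.diagonal (fun i => boolSign (ε i)) = 1 := by
  rw [Matrix.diagonal_mul_diagonal, ← Matrix.diagonal_one]
  congr 1
  ext i
  rw [← sq, boolSign_sq]

open Matrix in
theorem transpose_signMatrix_mul_self (A : Matrix m m ℝ) (ε ε' : m → Bool) :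
    (signMatrix A ε ε')ᵀ * signMatrix A ε ε' = Matrix.diagonal (fun j => boolSign (ε' j)) * (Aᵀ * A)
      * Matrix.diagonal (fun j => boolSign (ε' j)) := by
  have h := diagonal_boolSign_mul_self ε
  simp only [signMatrix, transpose_mul, diagonal_transpose, mul_assoc]
  rw [← mul_assoc (Matrix.diagonal (fun i => boolSign (ε i)))
    (Matrix.diagonal (fun i => boolSign (ε i))), h, one_mul]

open Matrix in
theorem signMatrix_sq_eq {A : Matrix m m ℝ} {c : ℝ} (hA : Aᵀ * A * (Aᵀ * A) = c • (Aᵀ * A))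
    (ε ε' : m → Bool) :
    (signMatrix A ε ε')ᵀ * signMatrix A ε ε' * ((signMatrix A ε ε')ᵀ * signMatrix A ε ε')
      = c • ((signMatrix A ε ε')ᵀ * signMatrix A ε ε') := by
  have h := diagonal_boolSign_mul_self ε'
  rw [transpose_signMatrix_mul_self, ← smul_mul_assoc, ← mul_smul_comm, ← hA]
  simp only [mul_assoc]
  rw [← mul_assoc (Matrix.diagonal (fun i => boolSign (ε' i)))
    (Matrix.diagonal (fun i => boolSign (ε' i))), h, one_mul]

open Matrix in
theorem trace_signMatrix (A : Matrix m m ℝ) (ε ε' : m → Bool) :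
    ((signMatrix A ε ε')ᵀ * signMatrix A ε ε').trace = (Aᵀ * A).trace := by
  rw [transpose_signMatrix_mul_self, trace_mul_cycle, diagonal_boolSign_mul_self, one_mul]

open scoped InnerProductSpace

theorem inner_matrixVec_signMatrix (A : Matrix m m ℝ) (ε ε' : m → Bool)
    (x : EuclideanSpace ℝ (m × m)) :
    ⟪matrixVec (signMatrix A ε ε'), x⟫_ℝ
      = ∑ i, boolSign (ε i) * ∑ j, boolSign (ε' j) * (A i j * x (i, j)) := by
  rw [PiLp.inner_apply, Fintype.sum_prod_type]
  refine Finset.sum_congr rfl fun i _ => ?_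
  rw [Finset.mul_sum]
  refine Finset.sum_congr rfl fun j _ => ?_
  change x (i, j) * signMatrix A ε ε' i j = _
  rw [signMatrix_apply]
  ring

omit [DecidableEq m] in
theorem norm_sq_euclidean_prod (x : EuclideanSpace ℝ (m × m)) :
    ‖x‖ ^ 2 = ∑ i, ∑ j, x (i, j) ^ 2 := by
  rw [EuclideanSpace.norm_sq_eq, Fintype.sum_prod_type]
  simp

theorem sum_inner_signMatrix_sq {A : Matrix m m ℝ} (hA : ∀ i j, A i j ^ 2 = 1)
    (x : EuclideanSpace ℝ (m × m)) :
    ∑ ε : m → Bool, ∑ ε' : m → Bool, ⟪matrixVec (signMatrix A ε ε'), x⟫_ℝ ^ 2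
      = 2 ^ Fintype.card m * (2 ^ Fintype.card m * ‖x‖ ^ 2) := by
  simp_rw [inner_matrixVec_signMatrix]
  rw [Finset.sum_comm]
  simp_rw [sum_sq_sum_boolSign, ← Finset.mul_sum]
  rw [Finset.sum_comm]
  simp_rw [sum_sq_sum_boolSign, ← Finset.mul_sum, mul_pow, hA, one_mul, norm_sq_euclidean_prod]

/-- Khintchine is applied to the row signs for fixed column signs, and to the column signs within
each row; the constant is `3 * 3 = 9`. -/
theorem sum_inner_signMatrix_pow_four_le {A : Matrix m m ℝ} (hA : ∀ i j, A i j ^ 2 = 1)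
    (x : EuclideanSpace ℝ (m × m)) :
    ∑ ε : m → Bool, ∑ ε' : m → Bool, ⟪matrixVec (signMatrix A ε ε'), x⟫_ℝ ^ 4
      ≤ 2 ^ Fintype.card m * (2 ^ Fintype.card m * (9 * ‖x‖ ^ 4)) := by
  simp_rw [inner_matrixVec_signMatrix]
  rw [Finset.sum_comm]
  set y : (m → Bool) → m → ℝ := fun ε' i => ∑ j, boolSign (ε' j) * (A i j * x (i, j)) with hy
  have h4 : ∀ i, ∑ ε', y ε' i ^ 4 ≤ 2 ^ Fintype.card m * (3 * (∑ j, x (i, j) ^ 2) ^ 2) := by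
    intro i
    have := sum_pow_four_sum_boolSign_le (fun j => A i j * x (i, j)) Finset.univ
    simpa only [mul_pow, hA, one_mul] using this
  set R : m → ℝ := fun i => ∑ j, x (i, j) ^ 2 with hR
  have hR0 : ∀ i, 0 ≤ R i := fun i => Finset.sum_nonneg fun _ _ => sq_nonneg _
  -- Cauchy–Schwarz over the column signs reduces the mixed moments to the fourth moments in `h4`.
  have hik : ∀ i k, ∑ ε', y ε' i ^ 2 * y ε' k ^ 2 ≤ 2 ^ Fintype.card m * (3 * (R i * R k)) := by
    intro i k
    have h := Finset.sum_mul_sq_le_sq_mul_sq Finset.univ (fun ε' => y ε' i ^ 2) fun ε' => y ε' k ^ 2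
    simp_rw [← pow_mul] at h
    norm_num at h
    refine abs_le_of_sq_le_sq' (h.trans ?_) (by have := hR0 i; have := hR0 k; positivity) |>.2
    refine (mul_le_mul (h4 i) (h4 k) (Finset.sum_nonneg fun _ _ => by positivity)
      (by positivity)).trans_eq ?_
    ring
  calc ∑ ε' : m → Bool, ∑ ε : m → Bool, (∑ i, boolSign (ε i) * y ε' i) ^ 4
      ≤ ∑ ε' : m → Bool, 2 ^ Fintype.card m * (3 * (∑ i, y ε' i ^ 2) ^ 2) :=
        Finset.sum_le_sum fun ε' _ => sum_pow_four_sum_boolSign_le (y ε') Finset.univ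
    _ = 2 ^ Fintype.card m * (3 * ∑ i, ∑ k, ∑ ε', y ε' i ^ 2 * y ε' k ^ 2) := by
        simp_rw [← Finset.mul_sum, sq (∑ i, y _ i ^ 2), Finset.sum_mul_sum]
        rw [Finset.sum_comm]
        congr 2
        refine Finset.sum_congr rfl fun i _ => Finset.sum_comm
    _ ≤ 2 ^ Fintype.card m * (3 * ∑ i, ∑ k, 2 ^ Fintype.card m * (3 * (R i * R k))) := by
        gcongr with i _ k _
        exact hik i k
    _ = 2 ^ Fintype.card m * (2 ^ Fintype.card m * (9 * ‖x‖ ^ 4)) := by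
        have : ‖x‖ ^ 4 = (∑ i, R i) * ∑ k, R k := by
          rw [← norm_sq_euclidean_prod]
          ring
        rw [this, Finset.sum_mul_sum]
        simp_rw [← Finset.mul_sum]
        ring

end Signs

/-! ### Hadamard matrices of order `2 ^ k` -/

section Hadamard

open Matrix
open scoped Kronecker

/-- Sylvester's construction: Kronecker powers of the matrix of order two. -/
theorem exists_isHadamard_two_pow (k : ℕ) : ∃ (m : Type) (_ : Fintype m) (_ : DecidableEq m)
    (A : Matrix m m ℝ), Fintype.card m = 2 ^ k ∧ A.IsHadamard := by
  induction k with
  | zero =>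
    refine ⟨Unit, inferInstance, inferInstance, 1, by simp, ⟨fun i j => ?_, ?_, ?_⟩⟩
    · rw [Subsingleton.elim i j, one_apply_eq]
      exact one_mem _
    · simp
    · simp
  | succ k ih =>
    obtain ⟨m, _, _, A, hm, hA⟩ := ih
    have h2 : (!![1, 1; 1, -1] : Matrix (Fin 2) (Fin 2) ℝ).IsHadamard := by
      refine ⟨fun i j => ?_, ?_, ?_⟩
      · rw [Unitary.mem_iff]
        fin_cases i <;> fin_cases j <;> simp
      · ext i j
        fin_cases i <;> fin_cases j <;> norm_num [mul_apply, Fin.sum_univ_two]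
      · ext i j
        fin_cases i <;> fin_cases j <;> norm_num [mul_apply, Fin.sum_univ_two]
    exact ⟨m × Fin 2, inferInstance, inferInstance, A ⊗ₖ !![1, 1; 1, -1],
      by simp [hm, pow_succ], hA.kronecker h2⟩

end Hadamard

/-! ### Comparison of Schatten norms of sign matrices -/

section Comparison

/-- A constant factor independent of `k` is lost on taking `k`-th roots; here this removes the
constant of `le_of_isotropic`. -/
theorem le_of_forall_mul_pow_le_pow {K x y : ℝ} (hK : 0 < K) (hx : 0 < x) (hy : 0 < y)
    (h : ∀ k : ℕ, K * x ^ k ≤ y ^ k) : x ≤ y := by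
  by_contra! hlt
  have h1 : Filter.Tendsto (fun k : ℕ => (y / x) ^ k) Filter.atTop (nhds 0) :=
    tendsto_pow_atTop_nhds_zero_of_lt_one (by positivity) ((div_lt_one hx).2 hlt)
  have h2 : K ≤ 0 := ge_of_tendsto' h1 fun k => by
    rw [div_pow, le_div_iff₀ (pow_pos hx k)]
    exact h k
  exact h2.not_gt hK

open Matrix

variable {𝕜 H : Type*} [RCLike 𝕜] [NormedAddCommGroup H] [InnerProductSpace 𝕜 H] [CompleteSpace H]
  {m : Type*} [Fintype m] [DecidableEq m]

/-- Changing signs of rows and columns preserves `G² = c G` and the trace of `G = AᵀA`, so `ψ` is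
constant on each of the two families of signed matrices, and their entries are isotropic. -/
theorem schattenNorm_le_of_sign_matrices {q : ℝ≥0∞} (hq : 0 < q) {r : ℝ} (hr0 : 0 < r) (hr : r < 2)
    {U : EuclideanSpace 𝕜 m →ₗᵢ[𝕜] H} (h : IsHomNegDefFun (schattenFun q r U) r)
    {A B : Matrix m m ℝ} (hA1 : ∀ i j, A i j ^ 2 = 1) (hB1 : ∀ i j, B i j ^ 2 = 1)
    {c d τ : ℝ} (hc : 0 < c) (hd : 0 < d) (hτ : 0 < τ)
    (hA : Aᵀ * A * (Aᵀ * A) = c • (Aᵀ * A)) (hB : Bᵀ * B * (Bᵀ * B) = d • (Bᵀ * B))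
    (hAτ : (Aᵀ * A).trace = τ) (hBτ : (Bᵀ * B).trace = τ) :
    (2 - 2 ^ (r / 2)) / 18 * (√c * (τ / c) ^ (1 / q.toReal)) ^ r
      ≤ (√d * (τ / d) ^ (1 / q.toReal)) ^ r := by
  let e : (Fin (Fintype.card m + Fintype.card m) → Bool) ≃ (m → Bool) × (m → Bool) :=
    Fintype.equivOfCardEq (by simp [pow_add])
  have hsum : ∀ f : (m → Bool) × (m → Bool) → ℝ, ∑ l, f (e l) = ∑ ε, ∑ ε', f (ε, ε') := fun f => by
    rw [e.sum_comp, Fintype.sum_prod_type]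
  refine h.le_of_isotropic hr0 hr (fun l => matrixVec (signMatrix A (e l).1 (e l).2))
    (fun l => matrixVec (signMatrix B (e l).1 (e l).2)) (fun x => ?_) (fun x => ?_) (fun x => ?_)
    (fun l => ?_) (fun l => ?_)
  · rw [hsum fun z => inner ℝ (matrixVec (signMatrix A z.1 z.2)) x ^ 2,
      sum_inner_signMatrix_sq hA1, pow_add, mul_assoc]
  · rw [hsum fun z => inner ℝ (matrixVec (signMatrix B z.1 z.2)) x ^ 2,
      sum_inner_signMatrix_sq hB1, pow_add, mul_assoc]
  · rw [hsum fun z => inner ℝ (matrixVec (signMatrix B z.1 z.2)) x ^ 4, pow_add, mul_assoc]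
    exact sum_inner_signMatrix_pow_four_le hB1 x
  · rw [schattenFun_matrixVec, schattenNorm_matrixOp_of_sq_eq U hq hc (signMatrix_sq_eq hA _ _)
      ((trace_signMatrix A _ _).trans hAτ) hτ]
  · rw [schattenFun_matrixVec, schattenNorm_matrixOp_of_sq_eq U hq hd (signMatrix_sq_eq hB _ _)
      ((trace_signMatrix B _ _).trans hBτ) hτ]

omit [DecidableEq m] in
theorem trace_transpose_mul_self_of_sq_eq_one {A : Matrix m m ℝ} (hA : ∀ i j, A i j ^ 2 = 1) :
    (Aᵀ * A).trace = (Fintype.card m : ℝ) ^ 2 := by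
  simp [trace, mul_apply, ← sq, hA]

omit [DecidableEq m] in
theorem all_ones_sq_eq : (of fun _ _ => 1 : Matrix m m ℝ)ᵀ * (of fun _ _ => 1 : Matrix m m ℝ)
      * ((of fun _ _ => 1 : Matrix m m ℝ)ᵀ * (of fun _ _ => 1 : Matrix m m ℝ))
    = (Fintype.card m : ℝ) ^ 2 •
      ((of fun _ _ => 1 : Matrix m m ℝ)ᵀ * (of fun _ _ => 1 : Matrix m m ℝ)) := by
  ext i j
  simp [mul_apply]
  ring

theorem Matrix.IsHadamard.sq_eq {A : Matrix m m ℝ} (hA : A.IsHadamard) :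
    Aᵀ * A * (Aᵀ * A) = (Fintype.card m : ℝ) • (Aᵀ * A) := by
  have h := hA.conjTranspose_mul
  rw [conjTranspose_eq_transpose_of_trivial] at h
  rw [h, smul_mul_assoc, one_mul]

theorem Matrix.IsHadamard.entry_sq {A : Matrix m m ℝ} (hA : A.IsHadamard) (i j : m) :
    A i j ^ 2 = 1 := by
  have h := Unitary.mul_star_self_of_mem (hA.apply_mem i j)
  rwa [star_trivial, ← sq] at h

end Comparison

/-! ### Failure of negative type in `C_q` for `q ≠ 2` -/

section NotNegativeType

open Matrix

variable {𝕜 H : Type*} [RCLike 𝕜] [NormedAddCommGroup H] [InnerProductSpace 𝕜 H] [CompleteSpace H]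

/-- For order `n = 2 ^ k`, the all-ones matrix has the single nonzero singular value `n`, and a
Hadamard matrix has `n` singular values `√n`. The norms are `2 ^ k` and `(√2 * 2 ^ t) ^ k`;
comparability in both directions with a constant independent of `k` forces `√2 * 2 ^ t = 2`. -/
theorem eq_half_of_lt_two {q : ℝ≥0∞} (hq : 0 < q) {r : ℝ} (hr0 : 0 < r) (hr : r < 2)
    (h : ∀ (m : Type) [Fintype m] [DecidableEq m], ∃ U : EuclideanSpace 𝕜 m →ₗᵢ[𝕜] H,
      IsHomNegDefFun (schattenFun q r U) r) : 1 / q.toReal = 1 / 2 := by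
  set t := 1 / q.toReal with ht
  have hK : 0 < (2 - (2 : ℝ) ^ (r / 2)) / 18 := by
    have : (2 : ℝ) ^ (r / 2) < 2 ^ (1 : ℝ) :=
      Real.rpow_lt_rpow_of_exponent_lt one_lt_two (by linarith)
    rw [Real.rpow_one] at this
    linarith
  have hs : (0 : ℝ) < √2 * 2 ^ t := by positivity
  have key : ∀ k : ℕ, (2 - (2 : ℝ) ^ (r / 2)) / 18 * (2 ^ r) ^ k ≤ ((√2 * 2 ^ t) ^ r) ^ k ∧
      (2 - (2 : ℝ) ^ (r / 2)) / 18 * ((√2 * 2 ^ t) ^ r) ^ k ≤ (2 ^ r) ^ k := by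
    intro k
    obtain ⟨m, _, _, A, hm, hA⟩ := exists_isHadamard_two_pow k
    obtain ⟨U, hU⟩ := h m
    have hcard : (Fintype.card m : ℝ) = 2 ^ k := by rw [hm]; push_cast; rfl
    have hn : (0 : ℝ) < Fintype.card m := by rw [hcard]; positivity
    have hJ : ∀ i j, (of fun _ _ => 1 : Matrix m m ℝ) i j ^ 2 = 1 := fun i j => by simp
    have e1 : (2 ^ r : ℝ) ^ k = (√((Fintype.card m : ℝ) ^ 2)
        * ((Fintype.card m : ℝ) ^ 2 / (Fintype.card m : ℝ) ^ 2) ^ t) ^ r := by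
      rw [div_self (by positivity), Real.one_rpow, mul_one, Real.sqrt_sq hn.le, hcard,
        Real.rpow_pow_comm zero_le_two]
    have e2 : ((√2 * 2 ^ t : ℝ) ^ r) ^ k = (√(Fintype.card m : ℝ)
        * ((Fintype.card m : ℝ) ^ 2 / (Fintype.card m : ℝ)) ^ t) ^ r := by
      rw [pow_two, mul_div_assoc, div_self hn.ne', mul_one, hcard, Real.rpow_pow_comm hs.le,
        mul_pow, Real.rpow_pow_comm zero_le_two, Real.sqrt_eq_rpow, Real.sqrt_eq_rpow,
        Real.rpow_pow_comm zero_le_two]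
    rw [e1, e2]
    exact ⟨schattenNorm_le_of_sign_matrices hq hr0 hr hU hJ hA.entry_sq (by positivity) hn
        (by positivity) all_ones_sq_eq hA.sq_eq (trace_transpose_mul_self_of_sq_eq_one hJ)
        (trace_transpose_mul_self_of_sq_eq_one hA.entry_sq),
      schattenNorm_le_of_sign_matrices hq hr0 hr hU hA.entry_sq hJ hn (by positivity)
        (by positivity) hA.sq_eq all_ones_sq_eq (trace_transpose_mul_self_of_sq_eq_one hA.entry_sq)
        (trace_transpose_mul_self_of_sq_eq_one hJ)⟩
  have h1 := le_of_forall_mul_pow_le_pow hK (by positivity) (by positivity) fun k => (key k).1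
  have h2 := le_of_forall_mul_pow_le_pow hK (by positivity) (by positivity) fun k => (key k).2
  have h3 := (Real.rpow_left_inj zero_le_two hs.le hr0.ne').1 (h1.antisymm h2)
  rw [Real.sqrt_eq_rpow, ← Real.rpow_add two_pos] at h3
  have h4 := (Real.rpow_right_inj two_pos (by norm_num : (2 : ℝ) ≠ 1)).1
    ((Real.rpow_one 2).trans h3)
  linarith

/-- The two parallelogram inequalities read `2 * 2 ^ (t r) ≤ 4` and `2 * 2 ^ r ≤ 4 * 2 ^ (t r)`,
that is, `t r ≤ 1` and `r ≤ 1 + t r`. With `r ≥ 2` both are equalities. -/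
theorem eq_half_of_two_le {q : ℝ≥0∞} (hq : 0 < q) {r : ℝ} (hr : 2 ≤ r)
    {U : EuclideanSpace 𝕜 (Fin 2) →ₗᵢ[𝕜] H} (h : IsHomNegDefFun (schattenFun q r U) r) :
    1 / q.toReal = 1 / 2 := by
  set t := 1 / q.toReal with ht
  have hr0 : 0 < r := two_pos.trans_le hr
  have hval : ∀ a b τ : ℝ, a ^ 4 = a ^ 2 → b ^ 4 = b ^ 2 → a ^ 2 + b ^ 2 = τ → 0 < τ →
      schattenFun q r U (matrixVec !![a, 0; 0, b]) = (τ ^ t) ^ r := by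
    intro a b τ ha hb hτ hτ0
    have hG : (!![a, 0; 0, b] : Matrix (Fin 2) (Fin 2) ℝ)ᵀ * !![a, 0; 0, b]
        = !![a ^ 2, 0; 0, b ^ 2] := by
      ext i j
      fin_cases i <;> fin_cases j <;> simp [mul_apply, sq]
    rw [schattenFun_matrixVec, schattenNorm_matrixOp_of_sq_eq U hq one_pos (τ := τ) ?_ ?_ hτ0,
      Real.sqrt_one, one_mul, div_one]
    · rw [hG, mul_fin_two, one_smul]
      simp only [mul_zero, zero_mul, add_zero, zero_add, ← pow_add, Nat.reduceAdd, ha, hb]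
    · rw [hG, trace_fin_two, ← hτ]
      simp
  have v1 := hval 1 0 1 (by norm_num) (by norm_num) (by norm_num) one_pos
  have v2 := hval 0 1 1 (by norm_num) (by norm_num) (by norm_num) one_pos
  have v3 := hval 1 1 2 (by norm_num) (by norm_num) (by norm_num) two_pos
  have v4 := hval 1 (-1) 2 (by norm_num) (by norm_num) (by norm_num) two_pos
  have a1 : matrixVec (!![1, 0; 0, 0] : Matrix (Fin 2) (Fin 2) ℝ) + matrixVec !![0, 0; 0, 1]
      = matrixVec !![1, 0; 0, 1] := by
    ext ⟨i, j⟩; fin_cases i <;> fin_cases j <;> simp [matrixVec]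
  have a2 : matrixVec (!![1, 0; 0, 0] : Matrix (Fin 2) (Fin 2) ℝ) - matrixVec !![0, 0; 0, 1]
      = matrixVec !![1, 0; 0, -1] := by
    ext ⟨i, j⟩; fin_cases i <;> fin_cases j <;> simp [matrixVec]
  have a3 : matrixVec (!![1, 0; 0, 1] : Matrix (Fin 2) (Fin 2) ℝ) + matrixVec !![1, 0; 0, -1]
      = (2 : ℝ) • matrixVec !![1, 0; 0, 0] := by
    ext ⟨i, j⟩; fin_cases i <;> fin_cases j <;> norm_num [matrixVec]
  have a4 : matrixVec (!![1, 0; 0, 1] : Matrix (Fin 2) (Fin 2) ℝ) - matrixVec !![1, 0; 0, -1]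
      = (2 : ℝ) • matrixVec !![0, 0; 0, 1] := by
    ext ⟨i, j⟩; fin_cases i <;> fin_cases j <;> norm_num [matrixVec]
  have p1 := h.parallelogram_le hr0 (matrixVec !![1, 0; 0, 0]) (matrixVec !![0, 0; 0, 1])
  have p2 := h.parallelogram_le hr0 (matrixVec !![1, 0; 0, 1]) (matrixVec !![1, 0; 0, -1])
  rw [a1, a2, v1, v2, v3, v4] at p1
  rw [a3, a4, h.map_smul, h.map_smul, v1, v2, v3, v4] at p2
  rw [Real.one_rpow, Real.one_rpow, ← Real.rpow_mul zero_le_two] at p1 p2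
  rw [abs_of_pos two_pos] at p2
  have q1 : (2 : ℝ) ^ (t * r) ≤ 2 ^ (1 : ℝ) := by rw [Real.rpow_one]; linarith
  have q2 : (2 : ℝ) ^ r ≤ 2 ^ (1 + t * r) := by
    rw [Real.rpow_add two_pos, Real.rpow_one]; linarith
  rw [Real.rpow_le_rpow_left_iff one_lt_two] at q1 q2
  have hr2 : r = 2 := by linarith
  rw [hr2] at q1 q2
  linarith

theorem not_isNegativeType_schattenDist (hH : ¬ FiniteDimensional 𝕜 H) {q : ℝ≥0∞} (hq : 0 < q)
    (hq2 : q ≠ 2) {p : ℝ} (hp : 0 < p) :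
    ¬ IsNegativeType (schattenDist q : SchattenClass 𝕜 H q → SchattenClass 𝕜 H q → ℝ) p := by
  intro h
  have hmin : 0 < (min 1 q).toReal :=
    ENNReal.toReal_pos (lt_min one_pos hq).ne' (min_lt_of_left_lt ENNReal.one_lt_top).ne
  have hU : ∀ (m : Type) [Fintype m] [DecidableEq m], ∃ U : EuclideanSpace 𝕜 m →ₗᵢ[𝕜] H,
      IsHomNegDefFun (schattenFun q ((min 1 q).toReal * p) U) ((min 1 q).toReal * p) := by
    intro m _ _
    obtain ⟨U⟩ := exists_linearIsometry_of_not_finiteDimensional hH m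
    exact ⟨U, isHomNegDefFun_schattenFun hq hp h U⟩
  have ht : 1 / q.toReal = 1 / 2 := by
    rcases lt_or_ge ((min 1 q).toReal * p) 2 with hr | hr
    · exact eq_half_of_lt_two hq (mul_pos hmin hp) hr hU
    · exact eq_half_of_two_le hq hr (hU (Fin 2)).choose_spec
  -- Now `q.toReal = 2`, which also excludes `q = ∞`, whose `toReal` is `0`.
  rw [one_div, one_div, _root_.inv_inj] at ht
  exact hq2 ((ENNReal.toReal_eq_toReal_iff' (fun h => by simp [h] at ht) (by simp)).1
    (by rw [ht]; rfl))

theorem exists_schattenDist_pos (hH : ¬ FiniteDimensional 𝕜 H) {q : ℝ≥0∞} (hq : 0 < q) :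
    ∃ S T : SchattenClass 𝕜 H q, S ≠ T ∧ 0 < schattenDist q S T := by
  obtain ⟨U⟩ := exists_linearIsometry_of_not_finiteDimensional hH Unit
  let S : SchattenClass 𝕜 H q := ⟨matrixOp U 1, isSchatten_matrixOp U hq _⟩
  let T : SchattenClass 𝕜 H q := ⟨matrixOp U 0, isSchatten_matrixOp U hq _⟩
  refine ⟨S, T, fun h => ?_, ?_⟩
  · have h1 : matrixOp U (1 - 0) = 0 := by
      rw [matrixOp_sub, sub_eq_zero]
      exact congrArg Subtype.val h
    have := congrFun (congrFun (matrixOp_eq_zero U h1) ()) ()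
    simp at this
  · have h1 : S.1 - T.1 = matrixOp U 1 := by
      change matrixOp U 1 - matrixOp U 0 = _
      rw [← matrixOp_sub, sub_zero]
    rw [schattenDist, h1, schattenNorm_matrixOp_of_sq_eq U hq one_pos (τ := 1) (by simp) (by simp)
      one_pos]
    simp

end NotNegativeType

theorem mainTheorem4 :
    (∀ (X : Type*) [MetricSpace X],
      supremalNegativeType (dist : X → X → ℝ) = 0 →
        polygonalSet (dist : X → X → ℝ) = Set.Ioi 0) ∧
    (∀ (𝕜 H : Type*) [RCLike 𝕜] [NormedAddCommGroup H] [InnerProductSpace 𝕜 H] [CompleteSpace H],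
      ¬ FiniteDimensional 𝕜 H →
      ∀ q : ℝ≥0∞, 0 < q → q ≠ 2 →
        supremalNegativeType (schattenDist q : SchattenClass 𝕜 H q → SchattenClass 𝕜 H q → ℝ) = 0 ∧
        polygonalSet (schattenDist q : SchattenClass 𝕜 H q → SchattenClass 𝕜 H q → ℝ)
          = Set.Ioi 0) := by
  refine ⟨fun X _ h => polygonalSet_dist_eq_Ioi X h, fun 𝕜 H _ _ _ _ hH q hq hq2 => ?_⟩
  have h := fun p hp => not_isNegativeType_schattenDist (𝕜 := 𝕜) (H := H) hH hq hq2 (p := p) hp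
  obtain ⟨S, T, hST, hpos⟩ := exists_schattenDist_pos (𝕜 := 𝕜) hH hq
  exact ⟨supremalNegativeType_eq_zero h, polygonalSet_eq_Ioi (schattenDist_comm hq) hST hpos h⟩
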